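/- Let $\mathbf N=\{1,2,\dots\}$. An ideal $\mathcal I$ is a family of subsets of $\mathbf N$ closed under subsets and finite unions, containing all finite sets, and different from $\mathcal P(\mathbf N)$; it is called meager, analytic or $F_\sigma$ if it is so as a subset of the Cantor space $\mathcal P(\mathbf N)\cong\{0,1\}^{\mathbf N}$, and a P-ideal if for every sequence $(S_n)$ in $\mathcal I$ there is $S\in\mathcal I$ with $S_n\setminus S$ finite for all $n$. For a sequence $u=(u_n)_{n\ge 1}$ in a topological space, $\eta$ is an $\mathcal I$-cluster point of $u$ if $\{n: u_n\in U\}\notin\mathcal I$ for every open $U\ni\eta$, and an $\mathcal I$-limit point of $u$ if there are $n_1<n_2<\cdots$ with $\{n_1,n_2,\dots\}\notin\mathcal I$ and $u_{n_j}\to\eta$. For $x\in(0,1]$ and an integer $b\ge2$ let $x=\sum_{n\ge1}d_{b,n}(x)b^{-n}$ be the unique nonterminating $b$-adic expansion of $x$. For $k\ge1$ and a string $\boldsymbol s=s_1\cdots s_k\in S_b^k:=\{0,\dots,b-1\}^k$ let $$\pi_{b,\boldsymbol s,n}(x)=\tfrac1n\,\#\{i\in\{1,\dots,n\}: d_{b,i+j-1}(x)=s_j\text{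 for }j=1,\dots,k\},\qquad \boldsymbol\pi^k_{b,n}(x)=(\pi_{b,\boldsymbol s,n}(x))_{\boldsymbol s\in S_b^k}\in\mathbf R^{b^k}.$$ Let $\Gamma_b^k(x,\mathcal I)$ and $\Lambda_b^k(x,\mathcal I)$ be the sets of $\mathcal I$-cluster points and of $\mathcal I$-limit points, respectively, of the sequence $(\boldsymbol\pi^k_{b,n}(x))_{n\ge1}$, and let $\Delta_b^k$ be the set of all $(p_{\boldsymbol s})\in\mathbf R^{b^k}$ with $p_{\boldsymbol s}\ge0$ for all $\boldsymbol s\in S_b^k$, $\sum_{\boldsymbol s}p_{\boldsymbol s}=1$, and $\sum_{s_0}p_{s_0\boldsymbol s}=\sum_{s_k}p_{\boldsymbol s s_k}$ for all $\boldsymbol s\in S_b^{k-1}$. Then, for every ideal $\mathcal I$ on $\mathbf N$: (i) if $\mathcal I$ is meager, the set $\{x\in(0,1]:\Gamma_b^k(x,\mathcal I)=\Delta_b^k\text{ for all }b\ge2,\ k\ge1\}$ has Hausdorff dimension $0$ and packing dimension $1$; (ii) if $\mathcal I$ is an analytic P-ideal or an $F_\sigma$-ideal, the set $\{x\in(0,1]:\Lambda_b^k(x,\mathcal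 I)=\Delta_b^k\text{ for all }b\ge2,\ k\ge1\}$ has Hausdorff dimension $0$ and packing dimension $1$. -/

import Mathlib

open Set Filter Topology
open scoped ENNReal NNReal

namespace NonNormal

/-! ### Ideals on the positive integers -/

/-- The standing convention on an ideal of subsets of the positive integers: on top of being closed
under subsets and finite unions (which is `Order.Ideal`), it contains all finite sets and is not the
whole power set. -/
structure IsAdmissible (I : Order.Ideal (Set ℕ+)) : Prop where
  finite_mem : ∀ S : Set ℕ+, S.Finite → S ∈ I
  univ_notMem : (univ : Set ℕ+) ∉ I

/-- The ideal as a subset of the Cantor space `{0,1}^ℕ+`, through characteristic functions.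
(`Bool` is discrete, `ℕ+ → Bool` has the product topology.) -/
def cantorSet (I : Order.Ideal (Set ℕ+)) : Set (ℕ+ → Bool) :=
  {f | {n | f n = true} ∈ I}

/-- A meager ideal. -/
def IsMeagerIdeal (I : Order.Ideal (Set ℕ+)) : Prop := IsMeagre (cantorSet I)

/-- An analytic ideal. -/
def IsAnalyticIdeal (I : Order.Ideal (Set ℕ+)) : Prop := MeasureTheory.AnalyticSet (cantorSet I)

/-- An `F_σ`-ideal: a countable union of closed subsets of the Cantor space. -/
def IsFSigmaIdeal (I : Order.Ideal (Set ℕ+)) : Prop :=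
  ∃ F : ℕ → Set (ℕ+ → Bool), (∀ n, IsClosed (F n)) ∧ cantorSet I = ⋃ n, F n

/-- A P-ideal: `σ`-directed modulo finite sets. -/
def IsPIdeal (I : Order.Ideal (Set ℕ+)) : Prop :=
  ∀ S : ℕ → Set ℕ+, (∀ n, S n ∈ I) → ∃ T ∈ I, ∀ n, (S n \ T).Finite

/-- `η` is an `I`-cluster point of the sequence `u`. -/
def IsIdealClusterPt {X : Type*} [TopologicalSpace X] (I : Order.Ideal (Set ℕ+)) (u : ℕ+ → X)
    (η : X) : Prop :=
  ∀ U : Set X, IsOpen U → η ∈ U → {n | u n ∈ U} ∉ I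

/-- `η` is an `I`-limit point of the sequence `u`: some subsequence, with index set not in `I`,
converges to `η`. -/
def IsIdealLimitPt {X : Type*} [TopologicalSpace X] (I : Order.Ideal (Set ℕ+)) (u : ℕ+ → X)
    (η : X) : Prop :=
  ∃ φ : ℕ → ℕ+, StrictMono φ ∧ range φ ∉ I ∧ Tendsto (fun m => u (φ m)) atTop (𝓝 η)

/-! ### Digits and frequencies of strings -/

/-- The `n`-th digit (`n ≥ 1`) of the nonterminating `b`-adic expansion of `x ∈ (0,1]`;
see `hasSum_digit`, `digit_lt` and `frequently_digit_ne_zero`. -/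
noncomputable def digit (b n : ℕ) (x : ℝ) : ℕ := (⌈(b : ℝ) ^ n * x⌉₊ - 1) % b

/-- The proportion of positions `i ∈ {1, …, n}` at which the string `s` of length `k` starts in the
nonterminating `b`-adic expansion of `x`. -/
noncomputable def freq (b k : ℕ) (x : ℝ) (n : ℕ+) (s : Fin k → Fin b) : ℝ :=
  (((Finset.Icc 1 (n : ℕ)).filter
    (fun i => ∀ j : Fin k, digit b (i + (j : ℕ)) x = (s j : ℕ))).card : ℝ) / ((n : ℕ) : ℝ)

/-- The set of vectors indexed by the strings of length `m + 1` in base `b` that are probability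
vectors with the compatibility condition: for each string `s` of length `m`, the total weight of the
strings `s₀s` is that of the strings `ss₀`. -/
def simplex (b m : ℕ) : Set ((Fin (m + 1) → Fin b) → ℝ) :=
  {p | ∑ s, p s = 1 ∧ (∀ s, 0 ≤ p s) ∧
    ∀ s : Fin m → Fin b,
      ∑ a : Fin b, p (Fin.cons (α := fun _ => Fin b) a s) =
        ∑ a : Fin b, p (Fin.snoc (α := fun _ => Fin b) s a)}

/-- The set of `x ∈ (0,1]` such that, for all bases `b ≥ 2` and all lengths `k = m + 1 ≥ 1`, the set
of `I`-cluster points of the sequence of frequency vectors of `x` is the whole `simplex b m`. -/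
def clusterSet (I : Order.Ideal (Set ℕ+)) : Set ℝ :=
  {x | x ∈ Ioc (0 : ℝ) 1 ∧ ∀ b : ℕ, 2 ≤ b → ∀ m : ℕ,
    {η | IsIdealClusterPt I (fun n => freq b (m + 1) x n) η} = simplex b m}

/-- The same with `I`-limit points in place of `I`-cluster points. -/
def limitSet (I : Order.Ideal (Set ℕ+)) : Set ℝ :=
  {x | x ∈ Ioc (0 : ℝ) 1 ∧ ∀ b : ℕ, 2 ≤ b → ∀ m : ℕ,
    {η | IsIdealLimitPt I (fun n => freq b (m + 1) x n) η} = simplex b m}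

/-! ### Packing measures and packing dimension -/

/-- `P` is a `δ`-packing of `F`: a collection of pairwise disjoint closed balls, each given by its
centre, which lies in `F`, and its radius, which is positive and at most `δ`. -/
def IsPacking {X : Type*} [MetricSpace X] (δ : ℝ) (F : Set X) (P : Set (X × ℝ)) : Prop :=
  (∀ p ∈ P, p.1 ∈ F ∧ 0 < p.2 ∧ p.2 ≤ δ) ∧
    P.PairwiseDisjoint (fun p => Metric.closedBall p.1 p.2)

/-- The `s`-dimensional packing premeasure `lim_{δ → 0} sup ∑ (2 r_i) ^ s`, the supremum being taken
over the `δ`-packings of `F`; it is monotone in `δ`, hence the limit is an infimum. -/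
noncomputable def packingPremeasure {X : Type*} [MetricSpace X] (s : ℝ) (F : Set X) : ℝ≥0∞ :=
  ⨅ (δ : ℝ) (_ : 0 < δ), ⨆ (P : Set (X × ℝ)) (_ : IsPacking δ F P),
    ∑' p : P, ENNReal.ofReal (2 * p.1.2) ^ s

/-- The `s`-dimensional packing (outer) measure. -/
noncomputable def packingMeasure {X : Type*} [MetricSpace X] (s : ℝ) (F : Set X) : ℝ≥0∞ :=
  ⨅ (G : ℕ → Set X) (_ : F ⊆ ⋃ i, G i), ∑' i, packingPremeasure s (G i)

/-- The packing dimension `sup {s ≥ 0 : 𝒫^s(F) = ∞}`. -/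
noncomputable def dimP {X : Type*} [MetricSpace X] (F : Set X) : ℝ≥0∞ :=
  ⨆ (s : ℝ≥0) (_ : packingMeasure (s : ℝ) F = ∞), (s : ℝ≥0∞)

/-! ### `digit` gives the nonterminating expansion -/

theorem digit_lt {b : ℕ} (hb : 2 ≤ b) (n : ℕ) (x : ℝ) : digit b n x < b :=
  Nat.mod_lt _ (by omega)

theorem sum_digit {b : ℕ} (hb : 2 ≤ b) {x : ℝ} (hx : x ∈ Ioc (0 : ℝ) 1) (n : ℕ) :
    ∑ i ∈ Finset.range n, (digit b (i + 1) x : ℝ) / (b : ℝ) ^ (i + 1) < x ∧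
      x ≤ ∑ i ∈ Finset.range n, (digit b (i + 1) x : ℝ) / (b : ℝ) ^ (i + 1) +
        1 / (b : ℝ) ^ n := by
  have hb0 : (0 : ℝ) < b := by exact_mod_cast (by omega : 0 < b)
  obtain ⟨hx0, hx1⟩ := hx
  have key : ∀ n : ℕ, (((⌈(b : ℝ) ^ n * x⌉₊ - 1 : ℕ) : ℝ) < (b : ℝ) ^ n * x) ∧
      (b : ℝ) ^ n * x ≤ ((⌈(b : ℝ) ^ n * x⌉₊ - 1 : ℕ) : ℝ) + 1 := by
    intro n
    have hp : 0 < (b : ℝ) ^ n * x := by positivity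
    have h1 : 1 ≤ ⌈(b : ℝ) ^ n * x⌉₊ := Nat.one_le_iff_ne_zero.2 (Nat.ceil_pos.2 hp).ne'
    have h2 := Nat.ceil_lt_add_one hp.le
    have h3 := Nat.le_ceil ((b : ℝ) ^ n * x)
    push_cast [Nat.cast_sub h1]
    constructor <;> linarith
  have hs : ∀ n : ℕ, ∑ i ∈ Finset.range n, (digit b (i + 1) x : ℝ) / (b : ℝ) ^ (i + 1) =
      ((⌈(b : ℝ) ^ n * x⌉₊ - 1 : ℕ) : ℝ) / (b : ℝ) ^ n := by
    intro n
    induction n with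
    | zero =>
      have : ⌈x⌉₊ ≤ 1 := Nat.ceil_le.2 (by simpa using hx1)
      have h0 : ⌈x⌉₊ - 1 = 0 := by omega
      simp [h0]
    | succ n ih =>
      rw [Finset.sum_range_succ, ih]
      obtain ⟨h1, h2⟩ := key n
      obtain ⟨h3, h4⟩ := key (n + 1)
      unfold digit
      generalize (⌈(b : ℝ) ^ n * x⌉₊ - 1 : ℕ) = c at *
      generalize (⌈(b : ℝ) ^ (n + 1) * x⌉₊ - 1 : ℕ) = d at *
      have e : (b : ℝ) ^ (n + 1) * x = b * ((b : ℝ) ^ n * x) := by ring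
      rw [e] at h3 h4
      have u1 : (b : ℝ) * c < b * ((b : ℝ) ^ n * x) := mul_lt_mul_of_pos_left h1 hb0
      have u2 : b * ((b : ℝ) ^ n * x) ≤ (b : ℝ) * (c + 1) := mul_le_mul_of_nonneg_left h2 hb0.le
      have v1 : b * c < d + 1 := by exact_mod_cast u1.trans_le h4
      have v2 : d < b * (c + 1) := by exact_mod_cast h3.trans_le u2
      have hdiv : d / b = c := by
        apply Nat.div_eq_of_lt_le
        · rw [mul_comm]; omega
        · rw [mul_comm]; exact v2
      have hd : (d : ℝ) = b * c + (d % b : ℕ) := by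
        have := Nat.div_add_mod d b
        rw [hdiv] at this
        exact_mod_cast this.symm
      rw [hd]
      field_simp
      ring
  rw [hs]
  have hpow : (0 : ℝ) < (b : ℝ) ^ n := by positivity
  obtain ⟨h1, h2⟩ := key n
  constructor
  · rw [div_lt_iff₀ hpow]; linarith
  · rw [← add_div, le_div_iff₀ hpow]; linarith

theorem hasSum_digit {b : ℕ} (hb : 2 ≤ b) {x : ℝ} (hx : x ∈ Ioc (0 : ℝ) 1) :
    HasSum (fun i : ℕ => (digit b (i + 1) x : ℝ) / (b : ℝ) ^ (i + 1)) x := by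
  rw [hasSum_iff_tendsto_nat_of_nonneg (fun i => by positivity)]
  have hb1 : (1 : ℝ) < b := by exact_mod_cast (by omega : 1 < b)
  have ht : Tendsto (fun n : ℕ => x - 1 / (b : ℝ) ^ n) atTop (𝓝 x) := by
    have := tendsto_pow_atTop_nhds_zero_of_lt_one (r := (b : ℝ)⁻¹) (by positivity)
      (inv_lt_one_of_one_lt₀ hb1)
    simpa [inv_pow] using this.const_sub x
  refine tendsto_of_tendsto_of_tendsto_of_le_of_le ht tendsto_const_nhds ?_ ?_
  · intro n
    have := (sum_digit hb hx n).2
    simp only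
    linarith
  · intro n
    exact (sum_digit hb hx n).1.le

theorem frequently_digit_ne_zero {b : ℕ} (hb : 2 ≤ b) {x : ℝ} (hx : x ∈ Ioc (0 : ℝ) 1) :
    ∃ᶠ n : ℕ in atTop, digit b n x ≠ 0 := by
  intro h
  simp only [not_not] at h
  obtain ⟨N, hN⟩ := eventually_atTop.1 h
  have h1 : HasSum (fun i : ℕ => (digit b (i + 1) x : ℝ) / (b : ℝ) ^ (i + 1))
      (∑ i ∈ Finset.range N, (digit b (i + 1) x : ℝ) / (b : ℝ) ^ (i + 1)) := by
    refine hasSum_sum_of_ne_finset_zero ?_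
    intro i hi
    have : digit b (i + 1) x = 0 := hN _ (by simp at hi; omega)
    simp [this]
  exact (sum_digit hb hx N).1.ne (h1.unique (hasSum_digit hb hx))

end NonNormal

namespace NonNormal

/-! ### Packing dimension on the line -/

/-! Hausdorff dimension. If all of `simplex 2 0` is attained, the point mass at the digit 0 is a
cluster point, so for every `q` infinitely many `n` have at most `n / q` nonzero binary digits up to
`n`. An exponential counting bound shows that, for suitable `q`, there are so few such prefixes that
the dyadic intervals they define have summable `d`-th powers of diameters, for any `d > 0`.

Packing dimension. A set residual in `(0,1)` has packing dimension at least 1: by Baire, every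
countable cover has a member dense in some interval, and such a member has infinite premeasure for
`s < 1`. So it suffices that `limitSet I`, a subset of `clusterSet I`, is residual when `I` is
meager (`isMeagre_diff_limitSet`). A meager ideal admits finite blocks `J k`, moving to infinity,
such that no member of `I` includes infinitely many of them (`exists_finsets_of_isMeagerIdeal`). Any
finite prefix extends to digits whose frequencies converge to a given strictly positive point of the
simplex (`exists_tendsto_wordFreq`), so generically the frequencies stay near any given point of the
simplex along a whole block, infinitely often. Conversely, cluster points lie in the simplex because
shifting a window changes counts by at most one.

Part (ii) concerns analytic ideals, and these are meager: a non-meager analytic set is residual in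
some open set, where a set and its complement modulo a finite set would both lie in the ideal. -/

theorem packingMeasure_mono {X : Type*} [MetricSpace X] (s : ℝ) {F G : Set X} (h : F ⊆ G) :
    packingMeasure s F ≤ packingMeasure s G :=
  le_iInf₂ fun H hH => iInf₂_le_of_le H (h.trans hH) le_rfl

theorem dimP_mono {X : Type*} [MetricSpace X] {F G : Set X} (h : F ⊆ G) : dimP F ≤ dimP G := by
  refine iSup₂_le fun s hs => ?_
  exact le_iSup₂_of_le s (top_unique (hs ▸ packingMeasure_mono _ h)) le_rfl

theorem packingPremeasure_empty {X : Type*} [MetricSpace X] (s : ℝ) :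
    packingPremeasure s (∅ : Set X) = 0 := by
  refine nonpos_iff_eq_zero.1 (iInf₂_le_of_le 1 one_pos (iSup₂_le fun P hP => ?_))
  have : P = ∅ := eq_empty_of_forall_notMem fun p hp => (hP.1 p hp).1
  subst this
  simp

theorem packingMeasure_le_packingPremeasure {X : Type*} [MetricSpace X] (s : ℝ) (F : Set X) :
    packingMeasure s F ≤ packingPremeasure s F := by
  refine iInf₂_le_of_le (fun i => if i = 0 then F else ∅) ?_ ?_
  · exact fun x hx => mem_iUnion.2 ⟨0, by simpa using hx⟩
  · rw [tsum_eq_single 0]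
    · simp
    · intro i hi
      simp [hi, packingPremeasure_empty]

/-- Disjoint balls of radius at most 1/2 centred in `[0,1]` have total length at most that of
`[-1,2]`, and a diameter at most 1 only shrinks under the power `s ≥ 1`. -/
theorem packingPremeasure_ne_top {s : ℝ} (hs : 1 ≤ s) {F : Set ℝ} (hF : F ⊆ Icc 0 1) :
    packingPremeasure s F ≠ ∞ := by
  have hle : packingPremeasure s F ≤ MeasureTheory.volume (Icc (-1 : ℝ) 2) := by
    refine iInf₂_le_of_le (1 / 2) (by norm_num) (iSup₂_le fun P hP => ?_)
    calc ∑' p : P, ENNReal.ofReal (2 * p.1.2) ^ s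
        ≤ ∑' p : P, MeasureTheory.volume (Metric.closedBall p.1.1 p.1.2) := by
          refine ENNReal.tsum_le_tsum fun p => ?_
          rw [Real.volume_closedBall]
          have h1 : ENNReal.ofReal (2 * p.1.2) ≤ 1 := by
            rw [ENNReal.ofReal_le_one]
            linarith [(hP.1 p.1 p.2).2.2]
          simpa using ENNReal.rpow_le_rpow_of_exponent_ge h1 hs
      _ ≤ MeasureTheory.volume (⋃ p : P, Metric.closedBall p.1.1 p.1.2) := by
          refine MeasureTheory.tsum_meas_le_meas_iUnion_of_disjoint _
            (fun p => Metric.isClosed_closedBall.measurableSet) ?_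
          intro p q hpq
          exact hP.2 p.2 q.2 (fun h => hpq (Subtype.ext h))
      _ ≤ MeasureTheory.volume (Icc (-1 : ℝ) 2) := by
          refine MeasureTheory.measure_mono (iUnion_subset fun p y hy => ?_)
          obtain ⟨h1, h2, h3⟩ := hP.1 p.1 p.2
          have h4 := hF h1
          rw [Real.closedBall_eq_Icc] at hy
          exact ⟨by linarith [hy.1, h4.1], by linarith [hy.2, h4.2]⟩
  refine ne_top_of_le_ne_top ?_ hle
  simp

theorem dimP_le_one {F : Set ℝ} (hF : F ⊆ Icc 0 1) : dimP F ≤ 1 := by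
  refine iSup₂_le fun s hs => ?_
  by_contra! h
  have h1 : (1 : ℝ) ≤ s := by exact_mod_cast h.le
  exact ne_top_of_le_ne_top (packingPremeasure_ne_top h1 hF)
    (packingMeasure_le_packingPremeasure _ _) hs

/-- Density allows `N` disjoint balls of radius of order `1 / N` centred in `G`; their sum is of
order `N ^ (1 - s)`, which is unbounded. -/
theorem packingPremeasure_eq_top {s u v : ℝ} (hs : s < 1) (huv : u < v) {G : Set ℝ}
    (hG : Ioo u v ⊆ closure G) : packingPremeasure s G = ∞ := by
  refine iInf₂_eq_top.2 fun δ hδ => ?_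
  have hl : 0 < v - u := sub_pos.2 huv
  have hlim : Tendsto (fun N : ℕ => (N : ℝ) * ((v - u) / (4 * N)) ^ s) atTop atTop := by
    have h1 : Tendsto (fun N : ℕ => ((v - u) / 4) ^ s * (N : ℝ) ^ (1 - s)) atTop atTop :=
      Tendsto.const_mul_atTop (by positivity)
        ((tendsto_rpow_atTop (sub_pos.2 hs)).comp tendsto_natCast_atTop_atTop)
    refine h1.congr' ?_
    filter_upwards [eventually_gt_atTop 0] with N hN
    have hN' : (0 : ℝ) < N := by exact_mod_cast hN
    rw [Real.rpow_sub hN', Real.rpow_one, ← div_div, Real.div_rpow (by positivity) hN'.le]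
    ring
  have hr : Tendsto (fun N : ℕ => (v - u) / (8 * N)) atTop (𝓝 0) :=
    Tendsto.div_atTop tendsto_const_nhds
      (Tendsto.const_mul_atTop (by norm_num) tendsto_natCast_atTop_atTop)
  refine top_unique (le_of_tendsto (ENNReal.tendsto_ofReal_atTop.comp hlim) ?_)
  filter_upwards [eventually_gt_atTop 0, hr.eventually_lt_const hδ] with N hN hNδ
  have hN' : (0 : ℝ) < N := by exact_mod_cast hN
  set r := (v - u) / (8 * N) with hrdef
  have hr0 : 0 < r := by positivity
  have hvu : v - u = 8 * N * r := by rw [hrdef]; field_simp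
  -- Midpoints of `N` cells of length `8 * r`, each moved by less than `r` into `G`; centres then
  -- stay more than `6 * r` apart.
  have hex : ∀ i : Fin N, ∃ g ∈ G, |u + (8 * i + 4) * r - g| < r := by
    intro i
    have hi : ((i : ℕ) : ℝ) + 1 ≤ N := by exact_mod_cast i.2
    have hmem : u + (8 * i + 4) * r ∈ Ioo u v := by
      constructor
      · have : 0 < (8 * (i : ℝ) + 4) * r := by positivity
        linarith
      · nlinarith
    simpa [Real.dist_eq] using Metric.mem_closure_iff.1 (hG hmem) r hr0
  choose g hgG hg using hex
  have hsep : ∀ i j : Fin N, i < j → g i + 2 * r < g j := by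
    intro i j hij
    have h1 := abs_lt.1 (hg i)
    have h2 := abs_lt.1 (hg j)
    have : ((i : ℕ) : ℝ) + 1 ≤ (j : ℕ) := by exact_mod_cast hij
    nlinarith
  have hdisj : ∀ i j : Fin N, i < j →
      Disjoint (Metric.closedBall (g i) r) (Metric.closedBall (g j) r) := by
    intro i j hij
    refine Set.disjoint_left.2 fun y hy hy' => ?_
    rw [Real.closedBall_eq_Icc] at hy hy'
    linarith [hsep i j hij, hy.2, hy'.1]
  have hinj : Function.Injective (fun i => (g i, r)) := by
    intro i j hij
    by_contra hne
    have hgij : g i = g j := (Prod.ext_iff.1 hij).1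
    rcases lt_or_gt_of_ne hne with h | h
    · linarith [hsep i j h]
    · linarith [hsep j i h]
  refine le_iSup₂_of_le (range fun i => (g i, r)) ⟨?_, ?_⟩ ?_
  · rintro _ ⟨i, rfl⟩
    exact ⟨hgG i, hr0, hNδ.le⟩
  · rintro _ ⟨i, rfl⟩ _ ⟨j, rfl⟩ hij
    have hne : i ≠ j := fun h => hij (by rw [h])
    rcases lt_or_gt_of_ne hne with h | h
    · exact hdisj i j h
    · exact (hdisj j i h).symm
  · rw [tsum_range (fun p : ℝ × ℝ => ENNReal.ofReal (2 * p.2) ^ s) hinj]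
    have h2r : (v - u) / (4 * N) = 2 * r := by rw [hrdef]; field_simp; norm_num
    simp only [Function.comp_apply, tsum_fintype, Finset.sum_const, Finset.card_univ,
      Fintype.card_fin, nsmul_eq_mul]
    rw [h2r, ENNReal.ofReal_mul hN'.le, ENNReal.ofReal_natCast,
      ENNReal.ofReal_rpow_of_pos (by positivity)]

theorem one_le_dimP {F : Set ℝ} (hF : IsMeagre (Ioo 0 1 \ F)) : 1 ≤ dimP F := by
  have key : ∀ s : ℝ≥0, s < 1 → packingMeasure (s : ℝ) F = ∞ := by
    intro s hs
    refine iInf₂_eq_top.2 fun G hG => ?_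
    by_cases h : ∃ i, (interior (closure (G i))).Nonempty
    · obtain ⟨i, x, hx⟩ := h
      obtain ⟨u, v, hxuv, huv⟩ := mem_nhds_iff_exists_Ioo_subset.1 (isOpen_interior.mem_nhds hx)
      refine ENNReal.tsum_eq_top_of_eq_top ⟨i, packingPremeasure_eq_top (by exact_mod_cast hs)
        (hxuv.1.trans hxuv.2) (huv.trans interior_subset)⟩
    · push Not at h
      exfalso
      refine not_isMeagre_of_isOpen (isOpen_Ioo (a := (0 : ℝ)) (b := 1)) ⟨1 / 2, by norm_num⟩ ?_
      refine IsMeagre.mono (s := (Ioo 0 1 \ F) ∪ ⋃ i, G i) ?_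
        (hF.union (isMeagre_iUnion fun i => IsNowhereDense.isMeagre (h i)))
      · intro x hx
        by_cases hxF : x ∈ F
        · exact Or.inr (hG hxF)
        · exact Or.inl ⟨hx, hxF⟩
  refine le_of_forall_lt fun c hc => ?_
  lift c to ℝ≥0 using hc.ne_top
  obtain ⟨d, hcd, hd⟩ := ENNReal.lt_iff_exists_nnreal_btwn.1 hc
  exact hcd.trans_le (le_iSup₂_of_le d (key d (by exact_mod_cast hd)) le_rfl)

/-! ### Numbers whose binary expansion has a high upper density of zeros -/

theorem abs_sub_le_of_digit_eq {b : ℕ} (hb : 2 ≤ b) {x y : ℝ} (hx : x ∈ Ioc (0 : ℝ) 1)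
    (hy : y ∈ Ioc (0 : ℝ) 1) {n : ℕ} (h : ∀ i, 1 ≤ i → i ≤ n → digit b i x = digit b i y) :
    |x - y| ≤ 1 / (b : ℝ) ^ n := by
  have hxn := sum_digit hb hx n
  have hyn := sum_digit hb hy n
  rw [Finset.sum_congr rfl fun i hi => by
    rw [h (i + 1) (by omega) (by have := Finset.mem_range.1 hi; omega)]] at hxn
  rw [abs_le]
  constructor <;> linarith [hxn.1, hxn.2, hyn.1, hyn.2]

/-- The positions up to `n` of the nonzero binary digits of `x`. -/
noncomputable def nonzeroPositions (n : ℕ) (x : ℝ) : Finset ℕ :=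
  (Finset.Icc 1 n).filter fun i => digit 2 i x ≠ 0

theorem abs_sub_le_of_nonzeroPositions_eq {x y : ℝ} (hx : x ∈ Ioc (0 : ℝ) 1)
    (hy : y ∈ Ioc (0 : ℝ) 1) {n : ℕ} (h : nonzeroPositions n x = nonzeroPositions n y) :
    |x - y| ≤ 1 / (2 : ℝ) ^ n := by
  refine mod_cast abs_sub_le_of_digit_eq le_rfl hx hy fun i h1 hn => ?_
  have h2 : digit 2 i x ≠ 0 ↔ digit 2 i y ≠ 0 := by
    have := Finset.ext_iff.1 h i
    simpa [nonzeroPositions, h1, hn] using this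
  have h3 := digit_lt le_rfl i x
  have h4 := digit_lt le_rfl i y
  omega

/-- The weight `c ^ n * a ^ k` dominates the indicator of `q * k ≤ n`, as in a Chernoff bound. With
`a < 1` and `c = a ^ (-1/q)` it equals `a ^ (k - n/q)`, and `c` tends to 1 as `q` grows. -/
theorem exists_decay_rate {θ : ℝ} (hθ : 1 < θ) : ∃ (a c : ℝ) (q : ℕ), 0 < a ∧ 0 < c ∧
    c * (1 + a) < θ ∧ ∀ n k : ℕ, q * k ≤ n → 1 ≤ c ^ n * a ^ k := by
  set a : ℝ := min (1 / 2) ((θ - 1) / 2) with ha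
  have ha0 : 0 < a := lt_min (by norm_num) (by linarith)
  have ha1 : a ≤ 1 := (min_le_left _ _).trans (by norm_num)
  have haθ : 1 + a < θ := by linarith [min_le_right (1 / 2 : ℝ) ((θ - 1) / 2)]
  have hlim : Tendsto (fun q : ℕ => a ^ (-(1 / (q : ℝ))) * (1 + a)) atTop (𝓝 (1 + a)) := by
    have h1 : Tendsto (fun q : ℕ => -(1 / (q : ℝ))) atTop (𝓝 0) := by
      simpa using (tendsto_one_div_atTop_nhds_zero_nat (𝕜 := ℝ)).neg
    have h2 := ((Real.continuousAt_const_rpow (b := 0) ha0.ne').tendsto.comp h1).mul_const (1 + a)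
    simpa using h2
  obtain ⟨q, hq, hq0⟩ := ((hlim.eventually_lt_const haθ).and (eventually_gt_atTop 0)).exists
  refine ⟨a, a ^ (-(1 / (q : ℝ))), q, ha0, by positivity, hq, fun n k hk => ?_⟩
  have hq0' : (0 : ℝ) < q := by exact_mod_cast hq0
  rw [← Real.rpow_natCast, ← Real.rpow_natCast, ← Real.rpow_mul ha0.le, ← Real.rpow_add ha0]
  refine Real.one_le_rpow_of_pos_of_le_one_of_nonpos ha0 ha1 ?_
  have : (q : ℝ) * k ≤ n := by exact_mod_cast hk
  have h2 : -(1 / (q : ℝ)) * n + k = (q * k - n) / q := by field_simp; ring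
  rw [h2]
  exact div_nonpos_of_nonpos_of_nonneg (by linarith) hq0'.le

theorem card_filter_powerset_le {a c : ℝ} (ha : 0 < a) (hc : 0 < c) {q : ℕ}
    (h : ∀ n k : ℕ, q * k ≤ n → 1 ≤ c ^ n * a ^ k) (n : ℕ) :
    (((Finset.Icc 1 n).powerset.filter fun T => q * T.card ≤ n).card : ℝ) ≤
      (c * (1 + a)) ^ n := by
  have h1 := Finset.sum_pow_mul_eq_add_pow a 1 (Finset.Icc 1 n)
  simp only [one_pow, mul_one, Nat.card_Icc, Nat.add_sub_cancel] at h1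
  calc (((Finset.Icc 1 n).powerset.filter fun T => q * T.card ≤ n).card : ℝ)
      = ∑ T ∈ (Finset.Icc 1 n).powerset.filter fun T => q * T.card ≤ n, (1 : ℝ) := by simp
    _ ≤ ∑ T ∈ (Finset.Icc 1 n).powerset.filter fun T => q * T.card ≤ n, c ^ n * a ^ T.card :=
        Finset.sum_le_sum fun T hT => h n _ (Finset.mem_filter.1 hT).2
    _ ≤ ∑ T ∈ (Finset.Icc 1 n).powerset, c ^ n * a ^ T.card :=
        Finset.sum_le_sum_of_subset_of_nonneg (Finset.filter_subset _ _)
          fun T _ _ => by positivity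
    _ = (c * (1 + a)) ^ n := by
        rw [← Finset.mul_sum, h1, mul_pow, add_comm a 1]

theorem dimH_frequently_few_nonzero :
    dimH {x : ℝ | x ∈ Ioc (0 : ℝ) 1 ∧ ∀ q : ℕ, ∃ᶠ n in atTop,
      q * (nonzeroPositions n x).card ≤ n} = 0 := by
  set Z := {x : ℝ | x ∈ Ioc (0 : ℝ) 1 ∧ ∀ q : ℕ, ∃ᶠ n in atTop,
      q * (nonzeroPositions n x).card ≤ n} with hZ
  refine nonpos_iff_eq_zero.1 (le_of_forall_gt fun e he => ?_)
  obtain ⟨d, hd0, hde⟩ := ENNReal.lt_iff_exists_nnreal_btwn.1 he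
  refine lt_of_le_of_lt (dimH_le_of_hausdorffMeasure_ne_top ?_) hde
  have hd : (0 : ℝ) < d := by exact_mod_cast hd0
  obtain ⟨a, c, q, ha, hc, hac, hq⟩ := exists_decay_rate (Real.one_lt_rpow (x := 2) (by norm_num) hd)
  set P : ℕ → ℕ × Finset ℕ → Prop := fun N p =>
    N ≤ p.1 ∧ p.2 ∈ (Finset.Icc 1 p.1).powerset.filter fun T => q * T.card ≤ p.1 with hP
  -- Covers indexed by prefix length and set of nonzero positions; including `P N p` in the
  -- definition makes all other pieces empty.
  set t : ℕ → ℕ × Finset ℕ → Set ℝ := fun N p =>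
    {x | P N p ∧ x ∈ Ioc (0 : ℝ) 1 ∧ nonzeroPositions p.1 x = p.2} with ht
  have hdiam : ∀ N p, Metric.ediam (t N p) ≤ ENNReal.ofReal (1 / 2 ^ p.1) := by
    intro N p
    refine Metric.ediam_le_iff.2 fun x hx y hy => ?_
    rw [edist_dist, Real.dist_eq]
    exact ENNReal.ofReal_le_ofReal
      (abs_sub_le_of_nonzeroPositions_eq hx.2.1 hy.2.1 (hx.2.2.trans hy.2.2.symm))
  have hempty : ∀ N p, ¬ P N p → t N p = ∅ := fun N p h =>
    eq_empty_of_forall_notMem fun x hx => h hx.1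
  have hr : Tendsto (fun N : ℕ => ENNReal.ofReal (1 / 2 ^ N)) atTop (𝓝 0) := by
    rw [← ENNReal.ofReal_zero]
    refine ENNReal.tendsto_ofReal ?_
    simpa using tendsto_pow_atTop_nhds_zero_of_lt_one (r := (2 : ℝ)⁻¹) (by norm_num) (by norm_num)
  have hmeas := MeasureTheory.Measure.hausdorffMeasure_le_liminf_tsum (d : ℝ) Z _ hr t
    (Eventually.of_forall fun N p => by
      by_cases h : P N p
      · refine (hdiam N p).trans (ENNReal.ofReal_le_ofReal ?_)
        exact one_div_pow_le_one_div_pow_of_le (by norm_num) h.1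
      · simp [hempty N p h])
    (Eventually.of_forall fun N x hx => by
      obtain ⟨n, hn, hqn⟩ := frequently_atTop.1 (hx.2 q) N
      exact mem_iUnion.2 ⟨(n, nonzeroPositions n x), ⟨hn, Finset.mem_filter.2
        ⟨Finset.mem_powerset.2 (Finset.filter_subset _ _), hqn⟩⟩, hx.1, rfl⟩)
  -- There are at most `(c * (1 + a)) ^ n` pieces at level `n`, each contributing at most `2 ^ (-d *
  -- n)`.
  set ρ : ℝ := c * (1 + a) / 2 ^ (d : ℝ) with hρ
  have hρ0 : 0 ≤ ρ := by positivity
  have hρ1 : ρ < 1 := (div_lt_one (by positivity)).2 hac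
  have hbound : ∀ N, ∑' p, Metric.ediam (t N p) ^ (d : ℝ) ≤ ∑' n : ℕ, ENNReal.ofReal (ρ ^ n) := by
    intro N
    rw [ENNReal.tsum_prod']
    refine ENNReal.tsum_le_tsum fun n => ?_
    rw [tsum_eq_sum (s := (Finset.Icc 1 n).powerset.filter fun T => q * T.card ≤ n)
      (fun T hT => by rw [hempty N (n, T) fun h => hT h.2]; simp [hd])]
    calc ∑ T ∈ (Finset.Icc 1 n).powerset.filter fun T => q * T.card ≤ n,
          Metric.ediam (t N (n, T)) ^ (d : ℝ)
        ≤ ∑ T ∈ (Finset.Icc 1 n).powerset.filter fun T => q * T.card ≤ n,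
          ENNReal.ofReal (1 / (2 ^ (d : ℝ)) ^ n) := by
          refine Finset.sum_le_sum fun T _ => ?_
          refine (ENNReal.rpow_le_rpow (hdiam N (n, T)) hd.le).trans (le_of_eq ?_)
          rw [ENNReal.ofReal_rpow_of_pos (by positivity), Real.div_rpow (by norm_num) (by positivity),
            Real.one_rpow, ← Real.rpow_natCast, ← Real.rpow_natCast, ← Real.rpow_mul (by norm_num),
            ← Real.rpow_mul (by norm_num), mul_comm]
      _ ≤ ENNReal.ofReal (ρ ^ n) := by
          rw [Finset.sum_const, nsmul_eq_mul, ← ENNReal.ofReal_natCast,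
            ← ENNReal.ofReal_mul (by positivity)]
          refine ENNReal.ofReal_le_ofReal ?_
          rw [hρ, div_pow, mul_one_div]
          gcongr
          exact card_filter_powerset_le ha hc hq n
  refine ne_top_of_le_ne_top (b := ∑' n : ℕ, ENNReal.ofReal (ρ ^ n)) ?_
    (hmeas.trans (liminf_le_of_le ⟨0, by simp⟩ fun e he => ?_))
  · rw [← ENNReal.ofReal_tsum_of_nonneg (fun n => by positivity)
      (summable_geometric_of_lt_one hρ0 hρ1)]
    exact ENNReal.ofReal_ne_top
  · obtain ⟨N, hN⟩ := he.exists
    exact hN.trans (hbound N)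

/-! ### Non-meager analytic sets are residual in some open set -/

section Baire

variable {X : Type*} [TopologicalSpace X]

/-- The points all of whose neighbourhoods meet `S` in a non-meager set. -/
def baireEnvelope (S : Set X) : Set X :=
  {x | ∀ U : Set X, IsOpen U → x ∈ U → ¬ IsMeagre (S ∩ U)}

theorem isClosed_baireEnvelope (S : Set X) : IsClosed (baireEnvelope S) := by
  rw [← isOpen_compl_iff, isOpen_iff_forall_mem_open]
  intro x hx
  simp only [baireEnvelope, mem_compl_iff, mem_ofPred_eq, not_forall, not_not] at hx
  obtain ⟨U, hU, hxU, hm⟩ := hx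
  exact ⟨U, fun y hy h => h U hU hy hm, hU, hxU⟩

theorem baireEnvelope_subset_closure (S : Set X) : baireEnvelope S ⊆ closure S := by
  intro x hx
  rw [mem_closure_iff]
  intro U hU hxU
  rw [inter_comm]
  exact nonempty_of_not_isMeagre (hx U hU hxU)

/-- Only countably many basic open sets `U` are needed to witness that `S ∩ U` is meager. -/
theorem isMeagre_diff_baireEnvelope [SecondCountableTopology X] (S : Set X) :
    IsMeagre (S \ baireEnvelope S) := by
  have hB := TopologicalSpace.isBasis_countableBasis X
  refine IsMeagre.mono
    (s := ⋃ U ∈ {U ∈ TopologicalSpace.countableBasis X | IsMeagre (S ∩ U)}, S ∩ U) ?_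
    (isMeagre_biUnion ((TopologicalSpace.countable_countableBasis X).mono (sep_subset _ _))
      fun U hU => hU.2)
  rintro x ⟨hxS, hx⟩
  simp only [baireEnvelope, mem_ofPred_eq, not_forall, not_not] at hx
  obtain ⟨U, hU, hxU, hm⟩ := hx
  obtain ⟨V, hV, hxV, hVU⟩ := hB.exists_subset_of_mem_open hxU hU
  exact mem_iUnion₂.2 ⟨V, ⟨hV, hm.mono (inter_subset_inter_right _ hVU)⟩, hxS, hxV⟩

/-- Off the interiors of the envelopes of the `T n`, each `T n` is meager: part of it misses its
envelope, the rest lies in the boundary of a closed set. So `S` is meager there, and no open set of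
envelope points of `S` fits. -/
theorem isMeagre_baireEnvelope_diff_iUnion [SecondCountableTopology X] {S : Set X}
    {T : ℕ → Set X} (hST : S ⊆ ⋃ n, T n) :
    IsMeagre (baireEnvelope S \ ⋃ n, baireEnvelope (T n)) := by
  set V : Set X := ⋃ n, interior (baireEnvelope (T n)) with hV
  have hcl : IsClosed (baireEnvelope S \ V) :=
    (isClosed_baireEnvelope S).sdiff (isOpen_iUnion fun n => isOpen_interior)
  refine IsMeagre.mono (s := baireEnvelope S \ V)
    (sdiff_subset_sdiff_right (iUnion_mono fun n => interior_subset)) (IsNowhereDense.isMeagre ?_)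
  rw [hcl.isNowhereDense_iff, eq_empty_iff_forall_notMem]
  intro x hx
  refine (interior_subset hx).1 _ isOpen_interior hx ?_
  refine IsMeagre.mono (s := ⋃ n, ((T n \ baireEnvelope (T n)) ∪
    (baireEnvelope (T n) \ interior (baireEnvelope (T n))))) ?_ (isMeagre_iUnion fun n =>
      (isMeagre_diff_baireEnvelope _).union (IsNowhereDense.isMeagre ?_))
  · rintro y ⟨hyS, hy⟩
    obtain ⟨n, hn⟩ := mem_iUnion.1 (hST hyS)
    refine mem_iUnion.2 ⟨n, ?_⟩
    by_cases hyB : y ∈ baireEnvelope (T n)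
    · exact Or.inr ⟨hyB, fun h => (interior_subset hy).2 (mem_iUnion.2 ⟨n, h⟩)⟩
    · exact Or.inl ⟨hn, hyB⟩
  · rw [((isClosed_baireEnvelope _).sdiff isOpen_interior).isNowhereDense_iff,
      eq_empty_iff_forall_notMem]
    intro y hy
    exact (interior_subset hy).2 (interior_mono sdiff_subset hy)

/-- The sequences with initial segment `l`. -/
def seqCylinder (l : List ℕ) : Set (ℕ → ℕ) := {y | (List.range l.length).map y = l}

theorem exists_seqCylinder_subset (α : ℕ → ℕ) {U : Set (ℕ → ℕ)} (hU : IsOpen U) (hα : α ∈ U) :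
    ∃ n, seqCylinder ((List.range n).map α) ⊆ U := by
  obtain ⟨s, u, hu, hs⟩ := isOpen_pi_iff.1 hU α hα
  obtain ⟨n, hn⟩ := s.exists_nat_subset_range
  refine ⟨n, fun y hy => hs fun i hi => ?_⟩
  have h1 : y i = α i := by
    simp only [seqCylinder, List.length_map, List.length_range, mem_ofPred_eq,
      List.map_inj_left, List.mem_range] at hy
    exact hy i (Finset.mem_range.1 (hn hi))
  rw [h1]
  exact (hu i hi).2

/-- Write `A` as the range of a continuous `f` on Baire space and attach to each finite sequence `l`
the envelope `B l` of the image of its cylinder. Off a meager set, a point of `B l` lies in some `B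
(l ++ [k])`, so a point of `B []` follows an infinite branch, whose image under `f` must be that
point. -/
theorem exists_isOpen_isMeagre_diff [SecondCountableTopology X] [T2Space X] {A : Set X}
    (hA : MeasureTheory.AnalyticSet A) (hm : ¬ IsMeagre A) :
    ∃ U : Set X, IsOpen U ∧ U.Nonempty ∧ IsMeagre (U \ A) := by
  rw [MeasureTheory.AnalyticSet] at hA
  rcases hA with rfl | ⟨f, hf, rfl⟩
  · exact absurd IsMeagre.empty hm
  set B : List ℕ → Set X := fun l => baireEnvelope (f '' seqCylinder l) with hB
  have hnil : f '' seqCylinder [] = range f := by simp [seqCylinder]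
  have hstep : ∀ l : List ℕ, f '' seqCylinder l ⊆ ⋃ k : ℕ, f '' seqCylinder (l ++ [k]) := by
    rintro l _ ⟨y, hy, rfl⟩
    refine mem_iUnion.2 ⟨y l.length, y, ?_, rfl⟩
    simp only [seqCylinder, mem_ofPred_eq] at hy ⊢
    simp [List.range_succ, hy]
  have hbad : IsMeagre (⋃ l : List ℕ, B l \ ⋃ k, B (l ++ [k])) :=
    isMeagre_iUnion fun l => isMeagre_baireEnvelope_diff_iUnion (hstep l)
  have hgood : B [] \ (⋃ l : List ℕ, B l \ ⋃ k, B (l ++ [k])) ⊆ range f := by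
    rintro x ⟨hx, hx'⟩
    have hnext : ∀ l, x ∈ B l → ∃ k, x ∈ B (l ++ [k]) := by
      intro l hl
      by_contra h
      exact hx' (mem_iUnion.2 ⟨l, hl, by simpa using h⟩)
    choose! g hg using hnext
    set L : ℕ → List ℕ := fun n => Nat.rec [] (fun _ l => l ++ [g l]) n with hL
    have hLsucc : ∀ n, L (n + 1) = L n ++ [g (L n)] := fun n => rfl
    have hLmap : ∀ n, L n = (List.range n).map fun i => g (L i) := by
      intro n
      induction n with
      | zero => rfl
      | succ n ih => rw [hLsucc, List.range_succ, List.map_append, ← ih]; rfl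
    have hLB : ∀ n, x ∈ B (L n) := by
      intro n
      induction n with
      | zero => exact hx
      | succ n ih => exact hg _ ih
    refine ⟨fun i => g (L i), ?_⟩
    -- By continuity a cylinder along the branch maps into `U`, yet `x` lies in the closure of the
    -- image of every such cylinder.
    by_contra hne
    obtain ⟨U, V, hU, hV, hfU, hxV, hUV⟩ := t2_separation hne
    obtain ⟨n, hn⟩ := exists_seqCylinder_subset _ (hU.preimage hf) hfU
    rw [← hLmap] at hn
    obtain ⟨z, hzV, w, hw, rfl⟩ :=
      mem_closure_iff.1 (baireEnvelope_subset_closure _ (hLB n)) V hV hxV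
    exact disjoint_left.1 hUV (hn hw) hzV
  refine ⟨interior (B []), isOpen_interior, ?_, hbad.mono ?_⟩
  · by_contra hemp
    rw [not_nonempty_iff_eq_empty] at hemp
    refine hm ?_
    rw [← hnil]
    refine IsMeagre.mono (s := (f '' seqCylinder [] \ B []) ∪ B []) ?_
      ((isMeagre_diff_baireEnvelope _).union (IsNowhereDense.isMeagre
        ((isClosed_baireEnvelope _).isNowhereDense_iff.2 hemp)))
    intro y hy
    by_cases h : y ∈ B []
    · exact Or.inr h
    · exact Or.inl ⟨hy, h⟩
  · rintro y ⟨hy, hyf⟩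
    by_contra h
    exact hyf (hgood ⟨interior_subset hy, h⟩)

end Baire

/-! ### Meager ideals -/

open Classical in
/-- Switch the values at the points of `R`. -/
noncomputable def flipOn (R : Set ℕ+) (f : ℕ+ → Bool) : ℕ+ → Bool :=
  fun i => if i ∈ R then !f i else f i

theorem flipOn_flipOn (R : Set ℕ+) (f : ℕ+ → Bool) : flipOn R (flipOn R f) = f := by
  funext i
  by_cases h : i ∈ R <;> simp [flipOn, h]

theorem continuous_flipOn (R : Set ℕ+) : Continuous (flipOn R) := by
  refine continuous_pi fun i => ?_
  by_cases h : i ∈ R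
  · simp only [flipOn, h, if_true]
    exact (continuous_of_discreteTopology (f := Bool.not)).comp (continuous_apply (A := fun _ : ℕ+ => Bool) i)
  · simp only [flipOn, h, if_false]
    exact continuous_apply i

theorem isMeagre_preimage_flipOn (R : Set ℕ+) {F : Set (ℕ+ → Bool)} (hF : IsMeagre F) :
    IsMeagre (flipOn R ⁻¹' F) := by
  refine hF.preimage_of_isOpenMap (continuous_flipOn R) ?_
  exact (Homeomorph.mk ⟨flipOn R, flipOn R, flipOn_flipOn R, flipOn_flipOn R⟩
    (continuous_flipOn R) (continuous_flipOn R)).isOpenMap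

theorem exists_finset_agree_subset {U : Set (ℕ+ → Bool)} (hU : IsOpen U) {y : ℕ+ → Bool}
    (hy : y ∈ U) : ∃ T : Finset ℕ+, ∀ f : ℕ+ → Bool, (∀ i ∈ T, f i = y i) → f ∈ U := by
  obtain ⟨T, u, hu, hT⟩ := isOpen_pi_iff.1 hU y hy
  refine ⟨T, fun f hf => hT fun i hi => ?_⟩
  rw [hf i hi]
  exact (hu i hi).2

/-- Otherwise the ideal is residual in a cylinder fixing the coordinates in a finite `T`. Flipping
all coordinates off `T` is a homeomorphism preserving this cylinder, so some `f` and its flip both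
lie in the ideal; together with `T` they cover everything. -/
theorem isMeagerIdeal_of_isAnalyticIdeal {I : Order.Ideal (Set ℕ+)} (hI : IsAdmissible I)
    (hA : IsAnalyticIdeal I) : IsMeagerIdeal I := by
  by_contra hm
  obtain ⟨U, hU, ⟨y, hy⟩, hUm⟩ := exists_isOpen_isMeagre_diff hA hm
  obtain ⟨T, hT⟩ := exists_finset_agree_subset hU hy
  set N : Set (ℕ+ → Bool) := {f | ∀ i ∈ T, f i = y i} with hN
  have hNo : IsOpen N := by
    have : N = ⋂ i ∈ T, {f | f i = y i} := by ext f; simp [hN]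
    rw [this]
    exact isOpen_biInter_finset fun i _ =>
      (isOpen_discrete {y i}).preimage (continuous_apply (A := fun _ : ℕ+ => Bool) i)
  have hflip : ∀ f ∈ N, flipOn (T : Set ℕ+)ᶜ f ∈ N := by
    intro f hf i hi
    simpa [flipOn, hi] using hf i hi
  have h1 := hUm.union (isMeagre_preimage_flipOn (T : Set ℕ+)ᶜ hUm)
  have hex : ∃ f ∈ N, f ∈ cantorSet I ∧ flipOn (T : Set ℕ+)ᶜ f ∈ cantorSet I := by
    by_contra! hno
    refine not_isMeagre_of_isOpen hNo ⟨y, fun i _ => rfl⟩ (h1.mono fun f hf => ?_)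
    by_cases hfI : f ∈ cantorSet I
    · exact Or.inr ⟨hT _ (hflip f hf), hno f hf hfI⟩
    · exact Or.inl ⟨hT f hf, hfI⟩
  obtain ⟨f, hf, hf1, hf2⟩ := hex
  refine hI.univ_notMem ?_
  have h3 := Order.Ideal.sup_mem (Order.Ideal.sup_mem hf1 hf2) (hI.finite_mem T T.finite_toSet)
  refine I.lower ?_ h3
  intro i _
  by_cases hi : i ∈ T
  · exact Or.inr hi
  · left
    by_cases hfi : f i = true
    · exact Or.inl hfi
    · right
      simpa [flipOn, hi] using hfi

theorem IsFSigmaIdeal.isAnalyticIdeal {I : Order.Ideal (Set ℕ+)} (h : IsFSigmaIdeal I) :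
    IsAnalyticIdeal I := by
  obtain ⟨F, hF, hIF⟩ := h
  have : PolishSpace Bool := inferInstance
  rw [IsAnalyticIdeal, hIF]
  exact MeasureTheory.AnalyticSet.iUnion fun n => (hF n).analyticSet

/-- The union of the finitely many images of `F` under flips inside `S` is still closed and meager.
A basic neighbourhood of a point off this union avoids `F` whatever the values on `S` are. -/
theorem exists_pattern_notMem {F : Set (ℕ+ → Bool)} (hFc : IsClosed F) (hFm : IsMeagre F)
    (S : Finset ℕ+) : ∃ J : Finset ℕ+, Disjoint J S ∧ ∃ y : ℕ+ → Bool,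
      ∀ f : ℕ+ → Bool, (∀ i ∈ J, f i = y i) → f ∉ F := by
  classical
  set F' : Set (ℕ+ → Bool) := ⋃ R ∈ S.powerset, flipOn (R : Set ℕ+) ⁻¹' F with hF'
  have hc : IsClosed F' := isClosed_biUnion_finset fun R _ => hFc.preimage (continuous_flipOn _)
  have hm : IsMeagre F' :=
    isMeagre_biUnion (I := (S.powerset : Set (Finset ℕ+))) (Finset.countable_toSet _)
      fun R _ => isMeagre_preimage_flipOn _ hFm
  have hex : ∃ y, y ∉ F' := by
    by_contra! h
    exact not_isMeagre_of_isOpen isOpen_univ univ_nonempty (hm.mono fun y _ => h y)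
  obtain ⟨y, hy⟩ := hex
  obtain ⟨T, hT⟩ := exists_finset_agree_subset hc.isOpen_compl hy
  refine ⟨T \ S, Finset.sdiff_disjoint, y, fun f hf hfF => ?_⟩
  -- Flipping the disagreements inside `S` puts `f` into the neighbourhood of `y`.
  set R : Finset ℕ+ := S.filter fun i => f i ≠ y i with hR
  refine hT (flipOn (R : Set ℕ+) f) (fun i hi => ?_) ?_
  · by_cases hiS : i ∈ S
    · by_cases hfy : f i = y i
      · simp [flipOn, hR, hfy]
      · have : i ∈ (R : Set ℕ+) := by simp [hR, hiS, hfy]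
        simp only [flipOn, this, if_true]
        cases h1 : f i <;> cases h2 : y i <;> simp_all
    · have : i ∉ (R : Set ℕ+) := by simp [hR, hiS]
      simp only [flipOn, this, if_false]
      exact hf i (by simp [hi, hiS])
  · refine mem_biUnion (x := R) (Finset.mem_coe.2 (Finset.mem_powerset.2
      (Finset.filter_subset _ _))) ?_
    simpa [flipOn_flipOn] using hfF

theorem exists_closed_cover_of_isMeagre {X : Type*} [TopologicalSpace X] {s : Set X}
    (hs : IsMeagre s) : ∃ E : ℕ → Set X, (∀ n, IsClosed (E n) ∧ IsMeagre (E n)) ∧ Monotone E ∧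
      s ⊆ ⋃ n, E n := by
  obtain ⟨S, hS, hSc, hsS⟩ := isMeagre_iff_countable_union_isNowhereDense.1 hs
  obtain ⟨F, hF⟩ := (hSc.insert ∅).exists_eq_range (insert_nonempty _ _)
  have hFn : ∀ n, IsNowhereDense (F n) := by
    intro n
    have : F n ∈ insert ∅ S := hF ▸ mem_range_self n
    rcases this with h | h
    · rw [h]; exact isNowhereDense_empty
    · exact hS _ h
  refine ⟨fun n => ⋃ i ∈ Finset.range (n + 1), closure (F i), fun n => ⟨?_, ?_⟩, ?_, ?_⟩
  · exact isClosed_biUnion_finset fun i _ => isClosed_closure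
  · exact isMeagre_biUnion (I := (Finset.range (n + 1) : Set ℕ)) (Finset.countable_toSet _)
      fun i _ => (hFn i).closure.isMeagre
  · intro m n hmn
    exact biUnion_subset_biUnion_left fun i hi => by
      have := Finset.mem_range.1 hi
      exact Finset.mem_range.2 (by omega)
  · intro x hx
    obtain ⟨t, ht, hxt⟩ := hsS hx
    have : t ∈ range F := hF ▸ mem_insert_of_mem _ ht
    obtain ⟨n, rfl⟩ := this
    exact mem_iUnion.2 ⟨n, mem_biUnion (x := n) (by simp) (subset_closure hxt)⟩

/-- A meager ideal has a sequence of finite sets, moving to infinity, such that no member of the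
ideal includes infinitely many of them. -/
theorem exists_finsets_of_isMeagerIdeal {I : Order.Ideal (Set ℕ+)} (hI : IsMeagerIdeal I) :
    ∃ J : ℕ → Finset ℕ+, (∀ k, ∀ i ∈ J k, k < (i : ℕ)) ∧
      ∀ A : Set ℕ+, (∃ᶠ k in atTop, (J k : Set ℕ+) ⊆ A) → A ∉ I := by
  classical
  obtain ⟨E, hE, hEmono, hIE⟩ := exists_closed_cover_of_isMeagre hI
  -- Avoiding the positions `1, …, k + 1` pushes `J k` to infinity.
  choose J hJ y hy using fun k =>
    exists_pattern_notMem (hE k).1 (hE k).2 (Finset.Icc 1 k.succPNat)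
  have hJlt : ∀ k, ∀ i ∈ J k, k < (i : ℕ) := by
    intro k i hi
    by_contra! h
    refine Finset.disjoint_left.1 (hJ k) hi (Finset.mem_Icc.2 ⟨one_le, ?_⟩)
    rw [← PNat.coe_le_coe, Nat.succPNat_coe]
    omega
  refine ⟨J, hJlt, fun A hfreq hA => ?_⟩
  -- A subsequence of pairwise disjoint blocks inside `A`, so that their patterns can be prescribed
  -- independently.
  obtain ⟨f, hfA, hf⟩ := exists_seq_of_forall_finset_exists (fun k => (J k : Set ℕ+) ⊆ A)
    (fun k l => k < l ∧ Disjoint (J k) (J l)) (by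
      intro s _
      obtain ⟨l, hl, hlA⟩ := frequently_atTop.1 hfreq
        (s.sup fun k => k + 1 + (J k).sup fun i => (i : ℕ))
      refine ⟨l, hlA, fun k hk => ?_⟩
      have h1 : k + 1 + (J k).sup (fun i => (i : ℕ)) ≤ l :=
        (Finset.le_sup (f := fun k => k + 1 + (J k).sup fun i => (i : ℕ)) hk).trans hl
      refine ⟨by omega, Finset.disjoint_left.2 fun i hi hi' => ?_⟩
      have h2 := Finset.le_sup (f := fun i : ℕ+ => (i : ℕ)) hi
      have h3 := hJlt l i hi'
      omega)
  have hfmono : StrictMono f := strictMono_nat_of_lt_succ fun n => (hf n (n + 1) (by omega)).1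
  -- The support of `g` lies in `A`, but `g` has the forbidden pattern on every `J (f n)`; since `N
  -- ≤ f N` and `E` increases, it avoids every `E N`.
  set g : ℕ+ → Bool := fun i => decide (∃ n, i ∈ J (f n) ∧ y (f n) i = true) with hg
  have hgI : g ∈ cantorSet I := by
    refine I.lower ?_ hA
    intro i hi
    simp only [hg, mem_ofPred_eq, decide_eq_true_eq] at hi
    obtain ⟨n, hn, _⟩ := hi
    exact hfA n hn
  obtain ⟨N, hN⟩ := mem_iUnion.1 (hIE hgI)
  refine hy (f N) g (fun i hi => ?_) (hEmono (hfmono.id_le N) hN)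
  rw [Bool.eq_iff_iff]
  simp only [hg, decide_eq_true_eq]
  constructor
  · rintro ⟨n, hn, hyn⟩
    have : n = N := by
      by_contra hne
      rcases lt_or_gt_of_ne hne with h | h
      · exact Finset.disjoint_left.1 (hf n N h).2 hn hi
      · exact Finset.disjoint_left.1 (hf N n h).2 hi hn
    rwa [← this]
  · exact fun h => ⟨N, hi, h⟩

/-! ### Frequencies of strings in sequences of digits -/

/-- The string of length `k` that starts at position `i` of `e`. -/
def word {b : ℕ} (e : ℕ → Fin b) (k i : ℕ) : Fin k → Fin b := fun j => e (i + j)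

theorem word_succ_eq_snoc {b : ℕ} (e : ℕ → Fin b) (m i : ℕ) :
    word e (m + 1) i = Fin.snoc (α := fun _ => Fin b) (word e m i) (e (i + m)) := by
  rw [← Fin.snoc_init_self (α := fun _ => Fin b) (word e (m + 1) i)]
  rfl

theorem word_succ_eq_cons {b : ℕ} (e : ℕ → Fin b) (m i : ℕ) :
    word e (m + 1) i = Fin.cons (α := fun _ => Fin b) (e i) (word e m (i + 1)) := by
  rw [← Fin.cons_self_tail (α := fun _ => Fin b) (word e (m + 1) i)]
  congr 1
  funext j
  simp only [word, Fin.tail, Fin.val_succ]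
  congr 1
  omega

theorem word_succ_eq_snoc_iff {b m : ℕ} (e : ℕ → Fin b) (i : ℕ) (v : Fin m → Fin b) (a : Fin b) :
    word e (m + 1) i = Fin.snoc (α := fun _ => Fin b) v a ↔ word e m i = v ∧ e (i + m) = a := by
  rw [word_succ_eq_snoc, Fin.snoc_inj]

theorem word_succ_eq_cons_iff {b m : ℕ} (e : ℕ → Fin b) (i : ℕ) (v : Fin m → Fin b) (a : Fin b) :
    word e (m + 1) i = Fin.cons (α := fun _ => Fin b) a v ↔ word e m (i + 1) = v ∧ e i = a := by
  rw [word_succ_eq_cons, Fin.cons_inj, and_comm]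

/-- The number of positions `1, …, n` at which the string `s` starts in `e`. -/
def wordCount {b k : ℕ} (e : ℕ → Fin b) (n : ℕ) (s : Fin k → Fin b) : ℕ :=
  ((Finset.Icc 1 n).filter fun i => word e k i = s).card

/-- The proportion of positions `1, …, n` at which the string `s` starts in `e`. -/
noncomputable def wordFreq {b : ℕ} (e : ℕ → Fin b) (k n : ℕ) (s : Fin k → Fin b) : ℝ :=
  (wordCount e n s : ℝ) / n

theorem freq_eq_wordFreq {b k : ℕ} {x : ℝ} {e : ℕ → Fin b} {n : ℕ+}
    (h : ∀ i, 1 ≤ i → i ≤ n + k → digit b i x = e i) : freq b k x n = wordFreq e k n := by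
  funext s
  rw [freq, wordFreq, wordCount]
  congr 3
  refine Finset.filter_congr fun i hi => ?_
  rw [Finset.mem_Icc] at hi
  rw [funext_iff]
  refine forall_congr' fun j => ?_
  rw [h (i + j) (by omega) (by omega), word, Fin.ext_iff]

theorem wordCount_le {b k : ℕ} (e : ℕ → Fin b) (n : ℕ) (s : Fin k → Fin b) :
    wordCount e n s ≤ n := by
  rw [wordCount]
  exact (Finset.card_filter_le _ _).trans (by simp)

theorem wordCount_succ {b k : ℕ} (e : ℕ → Fin b) (n : ℕ) (s : Fin k → Fin b) :
    wordCount e (n + 1) s = wordCount e n s + if word e k (n + 1) = s then 1 else 0 := by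
  rw [wordCount, wordCount, Finset.card_filter, Finset.card_filter,
    Finset.sum_Icc_succ_top (by omega)]

theorem wordCount_congr {b k : ℕ} {e e' : ℕ → Fin b} {n : ℕ} (h : ∀ i < n + k, e i = e' i)
    (s : Fin k → Fin b) : wordCount e n s = wordCount e' n s := by
  rw [wordCount, wordCount]
  congr 1
  refine Finset.filter_congr fun i hi => ?_
  rw [Finset.mem_Icc] at hi
  have : word e k i = word e' k i := funext fun j => h _ (by omega)
  rw [this]

theorem sum_wordCount {b k : ℕ} (e : ℕ → Fin b) (n : ℕ) :
    ∑ s : Fin k → Fin b, wordCount e n s = n := by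
  have := Finset.card_eq_sum_card_fiberwise (s := Finset.Icc 1 n) (t := Finset.univ)
    (f := word e k) (fun _ _ => by simp)
  simpa [wordCount] using this.symm

theorem sum_wordCount_snoc {b m : ℕ} (e : ℕ → Fin b) (n : ℕ) (v : Fin m → Fin b) :
    ∑ a : Fin b, wordCount e n (Fin.snoc (α := fun _ => Fin b) v a) = wordCount e n v := by
  simp only [wordCount, word_succ_eq_snoc_iff, ← Finset.filter_filter]
  exact (Finset.card_eq_sum_card_fiberwise (t := Finset.univ) (f := fun i => e (i + m))
    (fun _ _ => by simp)).symm

/-- Both sides count the occurrences of `v` at positions `1, …, n + 1`: strings `av` see positions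
`2, …, n + 1`, strings `va` see `1, …, n`. -/
theorem sum_wordCount_cons {b m : ℕ} (e : ℕ → Fin b) (n : ℕ) (v : Fin m → Fin b) :
    ∑ a : Fin b, wordCount e n (Fin.cons (α := fun _ => Fin b) a v) +
      (if word e m 1 = v then 1 else 0) =
    ∑ a : Fin b, wordCount e n (Fin.snoc (α := fun _ => Fin b) v a) +
      if word e m (n + 1) = v then 1 else 0 := by
  have h1 : ∑ a : Fin b, wordCount e n (Fin.cons (α := fun _ => Fin b) a v) =
      ((Finset.Icc 1 n).filter fun i => word e m (i + 1) = v).card := by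
    simp only [wordCount, word_succ_eq_cons_iff, ← Finset.filter_filter]
    exact (Finset.card_eq_sum_card_fiberwise (t := Finset.univ) (f := e)
      (fun _ _ => by simp)).symm
  rw [sum_wordCount_snoc, ← wordCount_succ, h1]
  clear h1
  induction n with
  | zero =>
    rw [wordCount_succ]
    simp [wordCount]
  | succ n ih =>
    rw [wordCount_succ e (n + 1), ← ih, Finset.card_filter, Finset.card_filter,
      Finset.sum_Icc_succ_top (by omega)]
    omega

theorem wordFreq_mem_Icc {b k : ℕ} (e : ℕ → Fin b) (n : ℕ) :
    wordFreq e k n ∈ Icc (0 : (Fin k → Fin b) → ℝ) 1 := by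
  refine ⟨fun s => ?_, fun s => ?_⟩
  · simp only [wordFreq, Pi.zero_apply]
    positivity
  · exact div_le_one_of_le₀ (Nat.cast_le.2 (wordCount_le e n s)) (Nat.cast_nonneg _)

/-- The frequencies up to `n` violate the compatibility condition by at most `1 / n`. -/
theorem mem_simplex_of_tendsto {b m : ℕ} {e : ℕ → Fin b} {φ : ℕ → ℕ} (hφ : Tendsto φ atTop atTop)
    {η : (Fin (m + 1) → Fin b) → ℝ}
    (hη : Tendsto (fun j => wordFreq e (m + 1) (φ j)) atTop (𝓝 η)) : η ∈ simplex b m := by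
  have hs : ∀ s, Tendsto (fun j => wordFreq e (m + 1) (φ j) s) atTop (𝓝 (η s)) :=
    tendsto_pi_nhds.1 hη
  refine ⟨?_, fun s => ?_, fun v => ?_⟩
  · refine tendsto_nhds_unique (tendsto_finsetSum Finset.univ fun s _ => hs s)
      (tendsto_const_nhds.congr' ?_)
    filter_upwards [hφ.eventually_gt_atTop 0] with j hj
    simp only [wordFreq]
    rw [← Finset.sum_div, ← Nat.cast_sum, sum_wordCount, div_self (by positivity)]
  · exact ge_of_tendsto' (hs s) fun j => (wordFreq_mem_Icc e _).1 s
  · have h1 := (tendsto_finsetSum Finset.univ fun a _ =>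
      hs (Fin.cons (α := fun _ => Fin b) a v)).sub (tendsto_finsetSum Finset.univ
        fun (a : Fin b) _ => hs (Fin.snoc (α := fun _ => Fin b) v a))
    have h2 : Tendsto (fun j => 1 / (φ j : ℝ)) atTop (𝓝 0) :=
      (tendsto_one_div_atTop_nhds_zero_nat (𝕜 := ℝ)).comp hφ
    refine sub_eq_zero.1 (tendsto_nhds_unique h1 (squeeze_zero_norm (fun j => ?_) h2))
    simp only [wordFreq]
    rw [← Finset.sum_div, ← Finset.sum_div, ← sub_div, norm_div, Real.norm_natCast,
      ← Nat.cast_sum, ← Nat.cast_sum]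
    gcongr
    have h3 := sum_wordCount_cons e (φ j) v
    generalize ∑ a : Fin b, wordCount e (φ j) (Fin.cons (α := fun _ => Fin b) a v) = A at *
    generalize ∑ a : Fin b, wordCount e (φ j) (Fin.snoc (α := fun _ => Fin b) v a) = B at *
    have h4 : A ≤ B + 1 := by split_ifs at h3 <;> omega
    have h5 : B ≤ A + 1 := by split_ifs at h3 <;> omega
    have h4' : (A : ℝ) ≤ B + 1 := by exact_mod_cast h4
    have h5' : (B : ℝ) ≤ A + 1 := by exact_mod_cast h5
    rw [Real.norm_eq_abs, abs_le]
    constructor <;> linarith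

/-! ### Sequences with prescribed frequencies -/

/-- The total weight of the strings that extend `v` by one letter. -/
noncomputable def marginal {b m : ℕ} (p : (Fin (m + 1) → Fin b) → ℝ) (v : Fin m → Fin b) : ℝ :=
  ∑ a : Fin b, p (Fin.snoc (α := fun _ => Fin b) v a)

/-- The conditional probability of the letter `a` after the string `v`. -/
noncomputable def transition {b m : ℕ} (p : (Fin (m + 1) → Fin b) → ℝ) (v : Fin m → Fin b)
    (a : Fin b) : ℝ :=
  p (Fin.snoc (α := fun _ => Fin b) v a) / marginal p v

theorem marginal_pos {b m : ℕ} [NeZero b] {p : (Fin (m + 1) → Fin b) → ℝ} (hp : ∀ s, 0 < p s)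
    (v : Fin m → Fin b) : 0 < marginal p v :=
  Finset.sum_pos (fun _ _ => hp _) Finset.univ_nonempty

theorem sum_transition {b m : ℕ} [NeZero b] {p : (Fin (m + 1) → Fin b) → ℝ} (hp : ∀ s, 0 < p s)
    (v : Fin m → Fin b) : ∑ a : Fin b, transition p v a = 1 := by
  simp only [transition]
  rw [← Finset.sum_div]
  exact div_self (marginal_pos hp v).ne'

/-- A set of strings that is closed under dropping the last letter and prepending any letter is
empty or contains all strings. -/
theorem forall_of_init_cons {b m : ℕ} [NeZero b] {S : (Fin m → Fin b) → Prop}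
    (hS : ∀ v, S v → ∀ a : Fin b, S (Fin.init (α := fun _ => Fin b)
      (Fin.cons (α := fun _ => Fin b) a v))) {v : Fin m → Fin b} (hv : S v) (t : Fin m → Fin b) :
    S t := by
  -- `E` spells `t` followed by `v`; sliding the window left from position `m` to 0 turns `v` into
  -- `t`. The filler 0 lies beyond these windows.
  set E : ℕ → Fin b := fun i => if h : i < m then t ⟨i, h⟩ else
    if h : i - m < m then v ⟨i - m, h⟩ else 0 with hE
  have h0 : word E m m = v := by
    funext j
    simp [word, hE]
  have h1 : word E m 0 = t := by
    funext j
    simp [word, hE]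
  have hstep : ∀ i, S (word E m (i + 1)) → S (word E m i) := by
    intro i hi
    have := hS _ hi (E i)
    rwa [← word_succ_eq_cons, word_succ_eq_snoc, Fin.init_snoc] at this
  have hall : ∀ j, S (word E m j) → S (word E m 0) := by
    intro j
    induction j with
    | zero => exact id
    | succ j ih => exact fun h => ih (hstep j h)
  rw [← h1]
  exact hall m (h0 ▸ hv)

/-- Uniqueness of the stationary law of an irreducible chain. Summing over `a` turns the
inequalities into equalities, so `q` is `p` times a function `f` of the first `m` letters.
Compatibility makes `f` harmonic for the reversed chain; by the maximum principle it is constant,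
and the total mass makes it 1. -/
theorem eq_of_le_transition_mul_marginal {b m : ℕ} [NeZero b]
    {p q : (Fin (m + 1) → Fin b) → ℝ} (hp : p ∈ simplex b m) (hpos : ∀ s, 0 < p s)
    (hq : q ∈ simplex b m)
    (h : ∀ v a, q (Fin.snoc (α := fun _ => Fin b) v a) ≤ transition p v a * marginal q v) :
    q = p := by
  have heq : ∀ v a, q (Fin.snoc (α := fun _ => Fin b) v a) = transition p v a * marginal q v := by
    intro v a
    refine (Finset.sum_eq_sum_iff_of_le (s := Finset.univ) fun a _ => h v a).1 ?_ a
      (Finset.mem_univ _)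
    rw [← Finset.sum_mul, sum_transition hpos, one_mul]
    rfl
  set f : (Fin m → Fin b) → ℝ := fun v => marginal q v / marginal p v with hf
  have hqf : ∀ s : Fin (m + 1) → Fin b, q s = f (Fin.init (α := fun _ => Fin b) s) * p s := by
    intro s
    have := heq (Fin.init (α := fun _ => Fin b) s) (s (Fin.last m))
    rw [transition, Fin.snoc_init_self] at this
    rw [this, hf]
    ring
  obtain ⟨v₀, hv₀⟩ := Finite.exists_max f
  have hmax : ∀ t, f t = f v₀ := by
    refine forall_of_init_cons (S := fun v => f v = f v₀) (fun v hv a => ?_) rfl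
    have hsum : ∑ a : Fin b, q (Fin.cons (α := fun _ => Fin b) a v) =
        ∑ a : Fin b, f v₀ * p (Fin.cons (α := fun _ => Fin b) a v) := by
      rw [← Finset.mul_sum, hq.2.2, hp.2.2, ← hv]
      exact (div_mul_cancel₀ _ (marginal_pos hpos v).ne').symm
    have h1 := (Finset.sum_eq_sum_iff_of_le (s := Finset.univ) fun _ _ => by
      rw [hqf]
      exact mul_le_mul_of_nonneg_right (hv₀ _) (hpos _).le).1 hsum a (Finset.mem_univ _)
    rw [hqf] at h1
    exact mul_right_cancel₀ (hpos _).ne' h1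
  have hone : f v₀ = 1 := by
    have h1 : ∑ s, q s = ∑ s, f v₀ * p s := Finset.sum_congr rfl fun s _ => by rw [hqf, hmax]
    rw [← Finset.mul_sum, hq.1, hp.1, mul_one] at h1
    exact h1.symm
  funext s
  rw [hqf, hmax, hone, one_mul]

/-- The sequence each term of which is given by a rule from its index and the previous terms. -/
noncomputable def seqOfRule {X : Type*} [Inhabited X] (rule : ℕ → (ℕ → X) → X) : ℕ → X
  | n => rule n fun i => if _h : i < n then seqOfRule rule i else default

theorem exists_seq_of_rule {X : Type*} [Inhabited X] (rule : ℕ → (ℕ → X) → X) :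
    ∃ e : ℕ → X, ∀ n, ∃ h : ℕ → X, (∀ i < n, h i = e i) ∧ e n = rule n h := by
  refine ⟨seqOfRule rule, fun n => ⟨fun i => if i < n then seqOfRule rule i else default,
    fun i hi => by simp [hi], ?_⟩⟩
  rw [seqOfRule]
  simp

/-- A greedy choice of letters. After `v`, some letter `a` has its count below `transition p v a *
(wordCount h N v + 1)`, since over all `a` the left sides sum to the count of `v` and the right
sides to one more. The error `L + 1` pays for the prescribed prefix and for one greedy step. -/
theorem exists_wordCount_snoc_le {b m : ℕ} [NeZero b] {p : (Fin (m + 1) → Fin b) → ℝ}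
    (hpos : ∀ s, 0 < p s) (d : ℕ → Fin b) (L : ℕ) :
    ∃ e : ℕ → Fin b, (∀ i ≤ L, e i = d i) ∧ ∀ (n : ℕ) (v : Fin m → Fin b) (a : Fin b),
      (wordCount e n (Fin.snoc (α := fun _ => Fin b) v a) : ℝ) ≤
        transition p v a * wordCount e n v + (L + 1) := by
  have hnext : ∀ (h : ℕ → Fin b) (N : ℕ) (v : Fin m → Fin b), ∃ a : Fin b,
      (wordCount h N (Fin.snoc (α := fun _ => Fin b) v a) : ℝ) <
        transition p v a * (wordCount h N v + 1) := by
    intro h N v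
    have hlt : ∑ a : Fin b, (wordCount h N (Fin.snoc (α := fun _ => Fin b) v a) : ℝ) <
        ∑ a : Fin b, transition p v a * (wordCount h N v + 1) := by
      rw [← Finset.sum_mul, sum_transition hpos, ← Nat.cast_sum, sum_wordCount_snoc]
      linarith
    obtain ⟨a, -, ha⟩ := Finset.exists_lt_of_sum_lt hlt
    exact ⟨a, ha⟩
  choose g hg using hnext
  -- The letter at `n` completes the string of length `m + 1` starting at `n - m`; the counts up to
  -- `n - m - 1` involve only letters before `n`.
  obtain ⟨e, he⟩ := exists_seq_of_rule (X := Fin b) fun n h =>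
    if n ≤ L + m then d n else g h (n - m - 1) (word h m (n - m))
  refine ⟨e, fun i hi => ?_, fun n => ?_⟩
  · obtain ⟨h, -, hn⟩ := he i
    rw [hn, if_pos (by omega)]
  have htr : ∀ v a, 0 ≤ transition p v a := fun v a =>
    div_nonneg (hpos _).le (marginal_pos hpos v).le
  have hspec : ∀ i, L ≤ i →
      (wordCount e i (Fin.snoc (α := fun _ => Fin b) (word e m (i + 1)) (e (i + 1 + m))) : ℝ) <
        transition p (word e m (i + 1)) (e (i + 1 + m)) *
          (wordCount e i (word e m (i + 1)) + 1) := by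
    intro i hi
    obtain ⟨h, hh, hn⟩ := he (i + 1 + m)
    rw [if_neg (by omega), show i + 1 + m - m = i + 1 by omega, Nat.add_sub_cancel] at hn
    have hw : word h m (i + 1) = word e m (i + 1) := funext fun j => hh _ (by omega)
    have := hg h i (word h m (i + 1))
    rw [← hn, hw, wordCount_congr fun j hj => hh j (by omega),
      wordCount_congr fun j hj => hh j (by omega)] at this
    exact this
  induction n with
  | zero =>
    intro v a
    have := htr v a
    simp only [wordCount]
    simp
    positivity
  | succ n ih =>
    intro v a
    rcases lt_or_ge n L with hn | hn
    · have h1 : (wordCount e (n + 1) (Fin.snoc (α := fun _ => Fin b) v a) : ℝ) ≤ L := by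
        exact_mod_cast (wordCount_le _ _ _).trans (by omega)
      have h2 : 0 ≤ transition p v a * wordCount e (n + 1) v :=
        mul_nonneg (htr v a) (Nat.cast_nonneg _)
      linarith
    · rw [wordCount_succ, wordCount_succ]
      by_cases hs : word e (m + 1) (n + 1) = Fin.snoc (α := fun _ => Fin b) v a
      · rw [if_pos hs]
        rw [word_succ_eq_snoc_iff] at hs
        obtain ⟨rfl, rfl⟩ := hs
        rw [if_pos rfl]
        have := hspec n hn
        have hL : (0 : ℝ) ≤ L := Nat.cast_nonneg _
        push_cast
        linarith
      · rw [if_neg hs, add_zero]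
        refine (ih v a).trans ?_
        gcongr
        · exact htr v a
        · exact Nat.le_add_right _ _

/-- By compactness it is enough that each cluster point be `p`; the greedy bound divided by `n`
passes to the limit and uniqueness applies. -/
theorem exists_tendsto_wordFreq {b m : ℕ} [NeZero b] {p : (Fin (m + 1) → Fin b) → ℝ}
    (hp : p ∈ simplex b m) (hpos : ∀ s, 0 < p s) (d : ℕ → Fin b) (L : ℕ) :
    ∃ e : ℕ → Fin b, (∀ i ≤ L, e i = d i) ∧
      Tendsto (wordFreq e (m + 1)) atTop (𝓝 p) := by
  obtain ⟨e, hed, he⟩ := exists_wordCount_snoc_le hpos d L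
  refine ⟨e, hed, isCompact_Icc.tendsto_nhds_of_unique_mapClusterPt
    (Eventually.of_forall fun n => wordFreq_mem_Icc e n) fun q _ hq => ?_⟩
  obtain ⟨ψ, hψ, hψq⟩ := MapClusterPt.tendsto_subseq hq
  have hqs : ∀ s, Tendsto (fun j => wordFreq e (m + 1) (ψ j) s) atTop (𝓝 (q s)) :=
    tendsto_pi_nhds.1 hψq
  refine eq_of_le_transition_mul_marginal hp hpos
    (mem_simplex_of_tendsto hψ.tendsto_atTop hψq) fun v a => ?_
  have h1 : Tendsto (fun j => transition p v a * (∑ c : Fin b,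
      wordFreq e (m + 1) (ψ j) (Fin.snoc (α := fun _ => Fin b) v c)) + (L + 1) / (ψ j : ℝ))
      atTop (𝓝 (transition p v a * marginal q v + 0)) := by
    refine Tendsto.add (Tendsto.const_mul _ (tendsto_finsetSum _ fun c _ => hqs _)) ?_
    exact (tendsto_natCast_atTop_atTop.comp hψ.tendsto_atTop).const_div_atTop _
  rw [add_zero] at h1
  refine le_of_tendsto_of_tendsto' (hqs _) h1 fun j => ?_
  simp only [wordFreq]
  rw [← Finset.sum_div, ← Nat.cast_sum, sum_wordCount_snoc, ← mul_div_assoc, ← add_div]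
  gcongr
  exact he _ v a

theorem convex_simplex (b m : ℕ) : Convex ℝ (simplex b m) := by
  intro p hp q hq s t hs ht hst
  refine ⟨?_, fun w => ?_, fun v => ?_⟩
  · simp only [Pi.add_apply, Pi.smul_apply, smul_eq_mul]
    rw [Finset.sum_add_distrib, ← Finset.mul_sum, ← Finset.mul_sum, hp.1, hq.1]
    linarith
  · have h1 := hp.2.1 w
    have h2 := hq.2.1 w
    simp only [Pi.add_apply, Pi.smul_apply, smul_eq_mul]
    positivity
  · simp only [Pi.add_apply, Pi.smul_apply, smul_eq_mul]
    rw [Finset.sum_add_distrib, Finset.sum_add_distrib, ← Finset.mul_sum, ← Finset.mul_sum,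
      ← Finset.mul_sum, ← Finset.mul_sum, hp.2.2, hq.2.2]

/-- Mixing in a little of the uniform vector gives the positivity needed for conditional
probabilities and irreducibility. -/
theorem exists_pos_mem_simplex {b m : ℕ} [NeZero b] {p : (Fin (m + 1) → Fin b) → ℝ}
    (hp : p ∈ simplex b m) {U : Set ((Fin (m + 1) → Fin b) → ℝ)} (hU : IsOpen U) (hpU : p ∈ U) :
    ∃ q ∈ simplex b m, (∀ s, 0 < q s) ∧ q ∈ U := by
  have hb : (0 : ℝ) < b := Nat.cast_pos.2 (NeZero.pos b)
  set u : (Fin (m + 1) → Fin b) → ℝ := fun _ => 1 / (b : ℝ) ^ (m + 1) with hu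
  have hus : u ∈ simplex b m := by
    refine ⟨?_, fun s => by positivity, fun v => rfl⟩
    simp [hu]
  have hlim : Tendsto (fun t : ℝ => (1 - t) • p + t • u) (𝓝[>] 0) (𝓝 p) := by
    have : Continuous fun t : ℝ => (1 - t) • p + t • u := by fun_prop
    have h1 := this.tendsto 0
    simp only [sub_zero, one_smul, zero_smul, add_zero] at h1
    exact h1.mono_left nhdsWithin_le_nhds
  obtain ⟨t, htU, ht⟩ := ((hlim.eventually (hU.mem_nhds hpU)).and
    (Ioo_mem_nhdsGT (zero_lt_one (α := ℝ)))).exists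
  refine ⟨_, convex_simplex b m hp hus (sub_nonneg.2 ht.2.le) ht.1.le (by ring), fun s => ?_, htU⟩
  have h1 := mul_nonneg (sub_nonneg.2 ht.2.le) (hp.2.1 s)
  have h2 : 0 < t * u s := mul_pos ht.1 (by positivity)
  simp only [Pi.add_apply, Pi.smul_apply, smul_eq_mul]
  linarith

theorem exists_eventually_wordFreq_mem {b m : ℕ} [NeZero b]
    {U : Set ((Fin (m + 1) → Fin b) → ℝ)} (hU : IsOpen U) (hUs : (U ∩ simplex b m).Nonempty)
    (d : ℕ → Fin b) (L : ℕ) :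
    ∃ e : ℕ → Fin b, (∀ i ≤ L, e i = d i) ∧ ∀ᶠ n in atTop, wordFreq e (m + 1) n ∈ U := by
  obtain ⟨p, hpU, hp⟩ := hUs
  obtain ⟨q, hq, hpos, hqU⟩ := exists_pos_mem_simplex hp hU hpU
  obtain ⟨e, hed, he⟩ := exists_tendsto_wordFreq hq hpos d L
  exact ⟨e, hed, he.eventually (hU.mem_nhds hqU)⟩

/-! ### Ideal limit points and ideal cluster points -/

section IdealPoints

variable {X : Type*} {I : Order.Ideal (Set ℕ+)} {u : ℕ+ → X} {η : X}

theorem IsIdealLimitPt.isIdealClusterPt [TopologicalSpace X] (hI : IsAdmissible I)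
    (h : IsIdealLimitPt I u η) : IsIdealClusterPt I u η := by
  obtain ⟨φ, -, hφI, hφη⟩ := h
  intro U hU hηU hmem
  obtain ⟨N, hN⟩ := eventually_atTop.1 (hφη.eventually (hU.mem_nhds hηU))
  refine hφI (I.lower ?_ (Order.Ideal.sup_mem hmem
    (hI.finite_mem (φ '' Set.Iio N) ((Set.finite_Iio N).image φ))))
  rintro _ ⟨n, rfl⟩
  rcases lt_or_ge n N with hn | hn
  · exact Or.inr ⟨n, hn, rfl⟩
  · exact Or.inl (hN n hn)

theorem IsIdealClusterPt.exists_tendsto [PseudoMetricSpace X] (hI : IsAdmissible I)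
    (h : IsIdealClusterPt I u η) : ∃ φ : ℕ → ℕ+, Tendsto (fun j => (φ j : ℕ)) atTop atTop ∧
      Tendsto (fun j => u (φ j)) atTop (𝓝 η) := by
  have hex : ∀ j : ℕ, ∃ n : ℕ+, j ≤ (n : ℕ) ∧ dist (u n) η < 1 / ((j : ℝ) + 1) := by
    intro j
    by_contra! hno
    refine h (Metric.ball η (1 / ((j : ℝ) + 1))) Metric.isOpen_ball
      (Metric.mem_ball_self (by positivity)) (hI.finite_mem _ ?_)
    refine (Set.finite_Iio j.succPNat).subset fun n hn => ?_
    by_contra hnj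
    rw [Set.mem_Iio, not_lt, ← PNat.coe_le_coe, Nat.succPNat_coe] at hnj
    exact (hno n (by omega)).not_gt hn
  choose φ hφ hφη using hex
  refine ⟨φ, tendsto_atTop_mono hφ tendsto_id, tendsto_iff_dist_tendsto_zero.2 ?_⟩
  exact squeeze_zero (fun _ => dist_nonneg) (fun j => (hφη j).le)
    tendsto_one_div_add_atTop_nhds_zero_nat

/-- Take the union of blocks on which the error is below `1 / (j + 1)`. It includes infinitely many
`J k`, hence is not in `I`, and its increasing enumeration leaves any finite number of blocks for
good. -/
theorem isIdealLimitPt_of_forall_exists [PseudoMetricSpace X] (hI : IsAdmissible I)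
    {J : ℕ → Finset ℕ+} (hJ : ∀ A : Set ℕ+, (∃ᶠ k in atTop, (J k : Set ℕ+) ⊆ A) → A ∉ I)
    (h : ∀ ε > 0, ∀ K, ∃ k ≥ K, ∀ n ∈ J k, dist (u n) η < ε) : IsIdealLimitPt I u η := by
  choose k hk hkη using fun j : ℕ => h (1 / ((j : ℝ) + 1)) (by positivity) j
  set A : Set ℕ+ := ⋃ j, (J (k j) : Set ℕ+) with hA
  have hAI : A ∉ I := hJ A (frequently_atTop.2 fun j =>
    ⟨k j, hk j, subset_iUnion (fun j => (J (k j) : Set ℕ+)) j⟩)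
  have hinf : {n : ℕ | n.succPNat ∈ A}.Infinite := by
    intro hfin
    refine hAI (hI.finite_mem A ((hfin.image Nat.succPNat).subset fun i hi => ?_))
    exact ⟨i.natPred, (PNat.succPNat_natPred i).symm ▸ hi, by simp⟩
  set φ : ℕ → ℕ+ := fun m => (Nat.nth (fun n => n.succPNat ∈ A) m).succPNat with hφ
  have hφmono : StrictMono φ := Nat.succPNat_strictMono.comp (Nat.nth_strictMono hinf)
  have hφA : range φ = A := by
    ext i
    constructor
    · rintro ⟨m, rfl⟩
      exact Nat.nth_mem_of_infinite hinf m
    · intro hi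
      have : i.natPred ∈ range (Nat.nth fun n => n.succPNat ∈ A) := by
        rw [Nat.range_nth_of_infinite hinf]
        simpa using hi
      obtain ⟨m, hm⟩ := this
      exact ⟨m, by simp [hφ, hm]⟩
  refine ⟨φ, hφmono, hφA ▸ hAI, Metric.tendsto_nhds.2 fun ε hε => ?_⟩
  obtain ⟨N, hN⟩ := exists_nat_one_div_lt hε
  have hfin : (⋃ j ∈ Finset.range N, (J (k j) : Set ℕ+)).Finite :=
    Set.Finite.biUnion (Finset.finite_toSet _) fun j _ => Finset.finite_toSet _
  have hev := hφmono.injective.tendsto_cofinite.eventually hfin.compl_mem_cofinite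
  rw [Nat.cofinite_eq_atTop] at hev
  filter_upwards [hev] with m hm
  obtain ⟨j, hj⟩ := mem_iUnion.1 (hφA ▸ mem_range_self m : φ m ∈ A)
  have hNj : N ≤ j := by
    by_contra! hlt
    exact hm (mem_biUnion (x := j) (by simpa using hlt) hj)
  refine (hkη j _ hj).trans_le (le_trans ?_ hN.le)
  gcongr

end IdealPoints

/-- The digits of `x` as elements of `Fin b`. -/
noncomputable def digitFin {b : ℕ} (hb : 2 ≤ b) (x : ℝ) : ℕ → Fin b :=
  fun i => ⟨digit b i x, digit_lt hb i x⟩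

theorem freq_eq_wordFreq_digitFin {b : ℕ} (hb : 2 ≤ b) (k : ℕ) (x : ℝ) (n : ℕ+) :
    freq b k x n = wordFreq (digitFin hb x) k n :=
  freq_eq_wordFreq fun _ _ _ => rfl

theorem mem_simplex_of_isIdealClusterPt {I : Order.Ideal (Set ℕ+)} (hI : IsAdmissible I) {b : ℕ}
    (hb : 2 ≤ b) {m : ℕ} {x : ℝ} {η : (Fin (m + 1) → Fin b) → ℝ}
    (h : IsIdealClusterPt I (fun n => freq b (m + 1) x n) η) : η ∈ simplex b m := by
  obtain ⟨φ, hφ, hη⟩ := h.exists_tendsto hI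
  simp only [freq_eq_wordFreq_digitFin hb] at hη
  exact mem_simplex_of_tendsto hφ hη

theorem limitSet_subset_clusterSet {I : Order.Ideal (Set ℕ+)} (hI : IsAdmissible I) :
    limitSet I ⊆ clusterSet I := by
  rintro x ⟨hx, hxI⟩
  refine ⟨hx, fun b hb m => Subset.antisymm
    (fun η hη => mem_simplex_of_isIdealClusterPt hI hb hη) fun η hη => ?_⟩
  rw [← hxI b hb m] at hη
  exact IsIdealLimitPt.isIdealClusterPt hI hη

/-! ### Hausdorff dimension -/

theorem card_nonzeroPositions_add_wordCount (x : ℝ) (n : ℕ) :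
    (nonzeroPositions n x).card +
      wordCount (digitFin le_rfl x) n (fun _ : Fin 1 => (0 : Fin 2)) = n := by
  have h := Finset.card_filter_add_card_filter_not (s := Finset.Icc 1 n)
    (fun i => digit 2 i x ≠ 0)
  rw [Nat.card_Icc, Nat.add_sub_cancel] at h
  conv_rhs => rw [← h]
  rw [nonzeroPositions, wordCount]
  congr 2
  refine Finset.filter_congr fun i _ => ?_
  simp [word, funext_iff, digitFin, Fin.ext_iff]

theorem dimH_clusterSet {I : Order.Ideal (Set ℕ+)} (hI : IsAdmissible I) :
    dimH (clusterSet I) = 0 := by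
  refine nonpos_iff_eq_zero.1 ((dimH_mono ?_).trans dimH_frequently_few_nonzero.le)
  rintro x ⟨hx, hxI⟩
  refine ⟨hx, fun q => ?_⟩
  set z : Fin 1 → Fin 2 := fun _ => 0 with hz
  have hmem : Pi.single z (1 : ℝ) ∈ simplex 2 0 := by
    refine ⟨by simp, fun s => ?_, fun v => ?_⟩
    · exact (Pi.single_nonneg.2 zero_le_one : (0 : (Fin 1 → Fin 2) → ℝ) ≤ Pi.single z 1) s
    · refine Finset.sum_congr rfl fun a _ => ?_
      congr 1
      funext i
      rw [Subsingleton.elim (α := Fin 1) i 0]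
      rfl
  rw [← hxI 2 le_rfl 0] at hmem
  obtain ⟨φ, hφ, hη⟩ := IsIdealClusterPt.exists_tendsto hI hmem
  have h1 := tendsto_pi_nhds.1 hη z
  rw [Pi.single_eq_same] at h1
  -- A proportion of zeros above `q / (q + 1)` makes `q` times the number of nonzero digits less
  -- than the number of zeros.
  have hq : 1 - 1 / ((q : ℝ) + 1) < 1 := by
    have : 0 < 1 / ((q : ℝ) + 1) := by positivity
    linarith
  refine hφ.frequently (Eventually.frequently ?_)
  filter_upwards [h1.eventually_const_lt hq] with j hj
  rw [freq_eq_wordFreq_digitFin le_rfl, wordFreq] at hj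
  have hn : (0 : ℝ) < (φ j : ℕ) := by exact_mod_cast (φ j).pos
  have hcard : ((nonzeroPositions (φ j) x).card : ℝ) +
      wordCount (digitFin le_rfl x) (φ j) z = (φ j : ℕ) := by
    exact_mod_cast card_nonzeroPositions_add_wordCount x (φ j)
  rw [lt_div_iff₀ hn, ← hcard] at hj
  have h2 : (q : ℝ) * (nonzeroPositions (φ j) x).card ≤
      wordCount (digitFin le_rfl x) (φ j) z := by
    field_simp at hj
    nlinarith
  have h3 : (q : ℝ) * (nonzeroPositions (φ j) x).card ≤ (φ j : ℕ) :=
    h2.trans (by exact_mod_cast wordCount_le _ _ _)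
  exact_mod_cast h3

/-! ### Category -/

/-- Here `c` is the integer with `b`-adic digits `e 1, …, e M`; the interval is closed on the right
because expansions are nonterminating. -/
theorem exists_interval_digit_eq {b : ℕ} (hb : 2 ≤ b) (e : ℕ → Fin b) (M : ℕ) :
    ∃ c : ℕ, c + 1 ≤ b ^ M ∧ ∀ x ∈ Ioc ((c : ℝ) / (b : ℝ) ^ M) (((c : ℝ) + 1) / (b : ℝ) ^ M),
      ∀ i, 1 ≤ i → i ≤ M → digit b i x = e i := by
  have hb0 : (0 : ℝ) < b := by exact_mod_cast (by omega : 0 < b)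
  induction M with
  | zero => exact ⟨0, by simp, fun x _ i h1 h2 => by omega⟩
  | succ M ih =>
    obtain ⟨c, hc, ih⟩ := ih
    have he : (e (M + 1) : ℕ) + 1 ≤ b := (e (M + 1)).2
    have he' : ((e (M + 1) : ℕ) : ℝ) + 1 ≤ b := by exact_mod_cast he
    refine ⟨b * c + e (M + 1), ?_, fun x hx i h1 h2 => ?_⟩
    · calc b * c + e (M + 1) + 1 ≤ b * c + b := by omega
        _ = b * (c + 1) := by ring
        _ ≤ b * b ^ M := Nat.mul_le_mul_left _ hc
        _ = b ^ (M + 1) := by ring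
    · push_cast at hx
      obtain ⟨hx1, hx2⟩ := hx
      have hp : (0 : ℝ) < (b : ℝ) ^ (M + 1) := by positivity
      have hpM : (0 : ℝ) < (b : ℝ) ^ M := by positivity
      rw [div_lt_iff₀ hp] at hx1
      rw [le_div_iff₀ hp] at hx2
      rcases Nat.lt_or_ge M i with hi | hi
      · obtain rfl : i = M + 1 := by omega
        have hceil : ⌈(b : ℝ) ^ (M + 1) * x⌉₊ = b * c + e (M + 1) + 1 := by
          rw [Nat.ceil_eq_iff (by omega)]
          push_cast [Nat.add_sub_cancel]
          constructor <;> linarith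
        rw [digit, hceil, Nat.add_sub_cancel, Nat.mul_add_mod, Nat.mod_eq_of_lt (e (M + 1)).2]
      · refine ih x ⟨?_, ?_⟩ i h1 hi
        · rw [div_lt_iff₀ hpM]
          rw [pow_succ] at hx1
          have h0 : (0 : ℝ) ≤ (e (M + 1) : ℕ) := Nat.cast_nonneg _
          nlinarith
        · rw [le_div_iff₀ hpM]
          rw [pow_succ] at hx2
          nlinarith

/-- Near any point of `(0,1)`, keep `L` digits and continue with digits whose frequencies are
eventually in `U`. The condition on one block `J k` reads finitely many digits, so it holds on a
whole open interval. -/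
theorem isNowhereDense_diff_freq_mem {J : ℕ → Finset ℕ+} (hJ : ∀ k, ∀ i ∈ J k, k < (i : ℕ))
    {b : ℕ} (hb : 2 ≤ b) {m : ℕ} {U : Set ((Fin (m + 1) → Fin b) → ℝ)} (hU : IsOpen U)
    (hUs : (U ∩ simplex b m).Nonempty) (K : ℕ) :
    IsNowhereDense (Ioo (0 : ℝ) 1 \ {x | ∃ k ≥ K, ∀ n ∈ J k, freq b (m + 1) x n ∈ U}) := by
  have : NeZero b := ⟨by omega⟩
  have hb0 : (0 : ℝ) < b := by exact_mod_cast (by omega : 0 < b)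
  rw [IsNowhereDense, eq_empty_iff_forall_notMem]
  intro y hy
  obtain ⟨x₀, hx₀, hx₀S⟩ := mem_closure_iff.1 (interior_subset hy) _ isOpen_interior hy
  obtain ⟨ε, hε, hball⟩ := Metric.isOpen_iff.1 isOpen_interior x₀ hx₀
  obtain ⟨L, hL⟩ := exists_pow_lt_of_lt_one hε
    (inv_lt_one_of_one_lt₀ (by exact_mod_cast (by omega : 1 < b) : (1 : ℝ) < b))
  obtain ⟨e, hed, he⟩ := exists_eventually_wordFreq_mem hU hUs (digitFin hb x₀) L
  obtain ⟨N, hN⟩ := eventually_atTop.1 he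
  -- Elements of `J k` exceed `k ≥ N`, so the frequencies there are in `U`; `M` bounds all digits
  -- they read.
  set k := max K N with hk
  set M := max L ((J k).sup fun n => (n : ℕ) + (m + 1)) with hM
  obtain ⟨c, hc, hcM⟩ := exists_interval_digit_eq hb e M
  have hp : (0 : ℝ) < (b : ℝ) ^ M := by positivity
  have hc' : (c : ℝ) + 1 ≤ (b : ℝ) ^ M := by exact_mod_cast hc
  have hx : (c + 1 / 2 : ℝ) / b ^ M ∈ Ioo ((c : ℝ) / (b : ℝ) ^ M) (((c : ℝ) + 1) / b ^ M) := by
    constructor <;> gcongr <;> linarith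
  have h01 : ∀ x ∈ Ioo ((c : ℝ) / (b : ℝ) ^ M) (((c : ℝ) + 1) / b ^ M), x ∈ Ioc (0 : ℝ) 1 :=
    fun x hx => ⟨lt_of_le_of_lt (by positivity) hx.1, hx.2.le.trans ((div_le_one hp).2 hc')⟩
  have hsub : Ioo ((c : ℝ) / (b : ℝ) ^ M) (((c : ℝ) + 1) / b ^ M) ⊆ Metric.ball x₀ ε := by
    intro x hx
    have := abs_sub_le_of_digit_eq hb (h01 x hx) ⟨hx₀S.1.1, hx₀S.1.2.le⟩ (n := L)
      fun i h1 hi => by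
        rw [hcM x ⟨hx.1, hx.2.le⟩ i h1 (hi.trans (le_max_left _ _)), hed i hi, digitFin]
    rw [Metric.mem_ball, Real.dist_eq]
    rw [inv_pow, ← one_div] at hL
    exact this.trans_lt hL
  obtain ⟨x, hxW, -, hxD⟩ := mem_closure_iff.1 (interior_subset (hball (hsub hx))) _ isOpen_Ioo hx
  refine hxD ⟨k, le_max_left _ _, fun n hn => ?_⟩
  rw [freq_eq_wordFreq fun i h1 hi => hcM x ⟨hxW.1, hxW.2.le⟩ i h1 (hi.trans
    ((Finset.le_sup (f := fun n : ℕ+ => (n : ℕ) + (m + 1)) hn).trans (le_max_right _ _)))]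
  exact hN _ ((le_max_right K N).trans (hJ k n hn).le)

/-- A countable basis reduces the requirements for all `b`, `m`, all points of the simplex and all
precisions to countably many nowhere dense exceptions. -/
theorem isMeagre_diff_limitSet {I : Order.Ideal (Set ℕ+)} (hI : IsAdmissible I)
    (hm : IsMeagerIdeal I) : IsMeagre (Ioo 0 1 \ limitSet I) := by
  obtain ⟨J, hJ, hJI⟩ := exists_finsets_of_isMeagerIdeal hm
  have hbasis : ∀ b m : ℕ, TopologicalSpace.IsTopologicalBasis
      (TopologicalSpace.countableBasis ((Fin (m + 1) → Fin b) → ℝ)) :=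
    fun b m => TopologicalSpace.isBasis_countableBasis _
  set bad : (b m : ℕ) → Set ((Fin (m + 1) → Fin b) → ℝ) → ℕ → Set ℝ := fun b m U K =>
    Ioo (0 : ℝ) 1 \ {x | ∃ k ≥ K, ∀ n ∈ J k, freq b (m + 1) x n ∈ U} with hbad
  have hmeagre : IsMeagre (⋃ (b : ℕ) (m : ℕ), ⋃ U ∈ {U | U ∈ TopologicalSpace.countableBasis
      ((Fin (m + 1) → Fin b) → ℝ) ∧ 2 ≤ b ∧ (U ∩ simplex b m).Nonempty}, ⋃ K : ℕ,
      bad b m U K) := by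
    refine isMeagre_iUnion fun b => isMeagre_iUnion fun m => isMeagre_biUnion
      ((TopologicalSpace.countable_countableBasis _).mono fun U hU => hU.1) fun U hU =>
        isMeagre_iUnion fun K => ?_
    exact (isNowhereDense_diff_freq_mem hJ hU.2.1 ((hbasis b m).isOpen hU.1) hU.2.2 K).isMeagre
  refine hmeagre.mono ?_
  rintro x ⟨hx, hxL⟩
  by_contra hxbad
  refine hxL ⟨⟨hx.1, hx.2.le⟩, fun b hb m => Subset.antisymm (fun η hη =>
    mem_simplex_of_isIdealClusterPt hI hb (IsIdealLimitPt.isIdealClusterPt hI hη))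
    fun η hη => isIdealLimitPt_of_forall_exists hI hJI fun ε hε K => ?_⟩
  obtain ⟨U, hU, hηU, hUε⟩ := (hbasis b m).exists_subset_of_mem_open
    (Metric.mem_ball_self hε : η ∈ Metric.ball η ε) Metric.isOpen_ball
  by_contra hno
  refine hxbad (mem_iUnion₂.2 ⟨b, m, mem_iUnion₂.2 ⟨U, ⟨hU, hb, η, hηU, hη⟩,
    mem_iUnion.2 ⟨K, hx, ?_⟩⟩⟩)
  rintro ⟨k, hk, hkU⟩
  exact hno ⟨k, hk, fun n hn => hUε (hkU n hn)⟩

theorem limitSet_subset_Icc (I : Order.Ideal (Set ℕ+)) : limitSet I ⊆ Icc 0 1 :=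
  fun _ hx => Ioc_subset_Icc_self hx.1

theorem clusterSet_subset_Icc (I : Order.Ideal (Set ℕ+)) : clusterSet I ⊆ Icc 0 1 :=
  fun _ hx => Ioc_subset_Icc_self hx.1

end NonNormal

/-! ### The dimensions of the two sets -/

theorem proposition4p1 (I : Order.Ideal (Set ℕ+)) (hI : NonNormal.IsAdmissible I) :
    (NonNormal.IsMeagerIdeal I →
      dimH (NonNormal.clusterSet I) = 0 ∧ NonNormal.dimP (NonNormal.clusterSet I) = 1) ∧
    ((NonNormal.IsAnalyticIdeal I ∧ NonNormal.IsPIdeal I) ∨ NonNormal.IsFSigmaIdeal I →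
      dimH (NonNormal.limitSet I) = 0 ∧ NonNormal.dimP (NonNormal.limitSet I) = 1) := by
  have hsub := NonNormal.limitSet_subset_clusterSet hI
  have hdim : NonNormal.IsMeagerIdeal I → 1 ≤ NonNormal.dimP (NonNormal.limitSet I) :=
    fun hm => NonNormal.one_le_dimP (NonNormal.isMeagre_diff_limitSet hI hm)
  refine ⟨fun hm => ⟨NonNormal.dimH_clusterSet hI, le_antisymm
    (NonNormal.dimP_le_one (NonNormal.clusterSet_subset_Icc I))
    ((hdim hm).trans (NonNormal.dimP_mono hsub))⟩, fun h => ⟨?_, le_antisymm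
      (NonNormal.dimP_le_one (NonNormal.limitSet_subset_Icc I)) (hdim ?_)⟩⟩
  · exact nonpos_iff_eq_zero.1 ((dimH_mono hsub).trans (NonNormal.dimH_clusterSet hI).le)
  · exact NonNormal.isMeagerIdeal_of_isAnalyticIdeal hI
      (h.elim (fun h => h.1) fun h => h.isAnalyticIdeal)
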